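/- **Theorem (Recursive Distributional Equation).** Let $\alpha\in(0,2)$ and $\theta\in[0,1]$, and let $\ell_\theta(dx)=\theta\mathbf 1_{\{x>0\}}dx+(1-\theta)\mathbf 1_{\{x<0\}}dx$ on $\mathbb R$. Let $V=\mathbb N^f=\bigcup_{k\ge 0}\mathbb N^k$ be the set of finite words, regarded as a rooted tree with root the empty word $\varnothing$, in which the offspring of $v$ are the words $vk$, $k\in\mathbb N$. Consider a realization of the Poisson weighted infinite tree $\mathrm{PWIT}(\ell_\theta)$: real edge marks $(y_v)_{v\in V\setminus\{\varnothing\}}$, where $y_{vk}$ is the mark of the edge from $v$ to $vk$, such that the sequences $(y_{vk})_{k}$, $v\in V$, are independent and each of them is a Poisson point process on $\mathbb R$ of intensity $\ell_\theta$, enumerated so that $k\mapsto|y_{vk}|$ is nondecreasing. Let $\mathbf T$ be the operator on $L^2(V)$ obtained as the closure of the operator, defined on the finitely supported vectors, with matrix entries $$\langle\delta_v,\mathbf T\delta_w\rangle=\begin{cases}\operatorname{sign}(y_w)|y_w|^{-1/\alpha}&\text{if } w=vk\text{ for some }k,\\ \operatorname{sign}(y_v)|y_v|^{-1/\alpha}&\text{if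 } v=wk\text{ for some }k,\\ 0&\text{otherwise.}\end{cases}$$ Almost surely the columns of this matrix are square summable and $\mathbf T$ is self-adjoint, so that for every $z\in\mathbb C_+=\{z\in\mathbb C:\operatorname{Im}z>0\}$ the random variable $$h(z)=\langle\delta_\varnothing,(\mathbf T-zI)^{-1}\delta_\varnothing\rangle$$ is almost surely well defined (and it is measurable up to a null set). Moreover: 1. almost surely, $h(-\bar z)=-\overline{h(z)}$ for all $z\in\mathbb C_+$; 2. for every $z\in\mathbb C_+$, if $(h_k)_{k\in\mathbb N}$ are i.i.d. random variables with the law of $h(z)$, and $\{\xi_k\}_{k\in\mathbb N}$ is a Poisson point process on $(0,\infty)$ with intensity $\frac{\alpha}{2}x^{-\frac{\alpha}{2}-1}dx$, independent of $(h_k)_{k\in\mathbb N}$, then almost surely $\sum_k\xi_kh_k$ converges absolutely and $z+\sum_k\xi_kh_k\neq0$, and $$h(z)\overset{d}{=}-\Bigl(z+\sum_{k\in\mathbb N}\xi_kh_k\Bigr)^{-1}.$$ -/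

import Mathlib

open MeasureTheory ProbabilityTheory Filter Topology Set
open scoped ENNReal NNReal ComplexConjugate

noncomputable section

/-! ### Poisson point processes -/

/-- The number of indices `k` with `ξ k ω ∈ B`: the counting measure `∑ₖ δ_{ξₖ}` evaluated
at `B`. -/
def pointCount {Ω E : Type*} (ξ : ℕ → Ω → E) (B : Set E) (ω : Ω) : ℕ∞ :=
  {k : ℕ | ξ k ω ∈ B}.encard

/-- The random points `ξ 0, ξ 1, …` are an enumeration of a Poisson point process of intensity
`ν` (a σ-finite measure of infinite total mass in all uses below): the number of points in a
measurable set `B` of finite intensity is Poisson of mean `ν B`, and the numbers of points in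
pairwise disjoint measurable sets are independent. -/
structure IsPoissonPointProcess {Ω E : Type*} [MeasurableSpace Ω] [MeasurableSpace E]
    (P : Measure Ω) (ξ : ℕ → Ω → E) (ν : Measure E) : Prop where
  measurable : ∀ k, Measurable (ξ k)
  hasLaw_count : ∀ B : Set E, MeasurableSet B → ν B ≠ ∞ →
    HasLaw (pointCount ξ B) ((poissonMeasure (ν B).toNNReal).map (Nat.cast : ℕ → ℕ∞)) P
  indep_count : ∀ (m : ℕ) (B : Fin m → Set E), (∀ i, MeasurableSet (B i)) →
    Pairwise (fun i j => Disjoint (B i) (B j)) → iIndepFun (fun i => pointCount ξ (B i)) P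

/-! ### The Poisson weighted infinite tree -/

/-- The vertices of the infinite tree `ℕ^f = ⋃ₖ ℕᵏ`: finite words over `ℕ`. The root is the
empty word `[]`, and the offspring of `v` are the words `v ++ [k]`, `k : ℕ`. -/
abbrev TreeVertex : Type := List ℕ

/-- `y v ω` is the mark of the edge between the vertex `v ≠ []` and its parent (the value at the
root is irrelevant). The marks realize `PWIT(ν)`, for `ν` of infinite total mass: the mark
sequences below the different vertices are independent, and each of them is a Poisson point
process of intensity `ν` enumerated by increasing absolute values. -/
structure IsPWIT {Ω : Type*} [MeasurableSpace Ω] (P : Measure Ω) (ν : Measure ℝ)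
    (y : TreeVertex → Ω → ℝ) : Prop where
  poisson : ∀ v, IsPoissonPointProcess P (fun k => y (v ++ [k])) ν
  ordered : ∀ v, ∀ᵐ ω ∂P, Monotone fun k => |y (v ++ [k]) ω|
  indep : iIndepFun (fun (v : TreeVertex) (ω : Ω) (k : ℕ) => y (v ++ [k]) ω) P

/-- The measure `ℓ_θ(dx) = θ 1_{x > 0} dx + (1 - θ) 1_{x < 0} dx` on `ℝ`. -/
def twoSidedLebesgue (θ : ℝ) : Measure ℝ :=
  ENNReal.ofReal θ • volume.restrict (Ioi 0) + ENNReal.ofReal (1 - θ) • volume.restrict (Iio 0)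

/-! ### The operator on the tree -/

/-- The Hilbert space `L²(V)` of the vertex set. -/
abbrev TreeL2 : Type := lp (fun _ : TreeVertex => ℂ) 2

/-- The unit vector `δ_v`. -/
def treeDelta (v : TreeVertex) : TreeL2 := lp.single 2 v 1

/-- The weight `sign(t) |t|^{-1/α}` of an edge with mark `t`. -/
def edgeWeight (α t : ℝ) : ℝ := Real.sign t * |t| ^ (-1 / α)

open Classical in
/-- The matrix entries `T(v, w) = ⟨δ_v, T δ_w⟩` for the marks `t`. -/
def treeEntry (α : ℝ) (t : TreeVertex → ℝ) (v w : TreeVertex) : ℝ :=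
  if ∃ k, w = v ++ [k] then edgeWeight α (t w)
  else if ∃ k, v = w ++ [k] then edgeWeight α (t v)
  else 0

/-- The columns of the matrix `T` are square summable, so that `T` is defined on the finitely
supported vectors. -/
def TreeColumnsSquareSummable (α : ℝ) (t : TreeVertex → ℝ) : Prop :=
  ∀ w, Memℓp (fun v => (treeEntry α t v w : ℂ)) 2

open Classical in
/-- The vector `T δ_w`. -/
def treeColumn (α : ℝ) (t : TreeVertex → ℝ) (w : TreeVertex) : TreeL2 :=
  if h : Memℓp (fun v => (treeEntry α t v w : ℂ)) 2 then ⟨fun v => (treeEntry α t v w : ℂ), h⟩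
  else 0

/-- The space `𝓓` of finitely supported vectors of `L²(V)`. -/
def finSuppVectors : Submodule ℂ TreeL2 where
  carrier := {φ | (Function.support (φ : TreeVertex → ℂ)).Finite}
  zero_mem' := by
    change (Function.support (0 : TreeVertex → ℂ)).Finite
    simp only [Function.support_zero, Set.finite_empty]
  add_mem' := fun {φ ψ} hφ hψ => Set.Finite.subset (Set.Finite.union hφ hψ)
    (Function.support_add (φ : TreeVertex → ℂ) (ψ : TreeVertex → ℂ))
  smul_mem' := fun c φ hφ => Set.Finite.subset hφ
    (Function.support_const_smul_subset c (φ : TreeVertex → ℂ))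

/-- The coordinates of a finitely supported vector. -/
def finSuppCoords : finSuppVectors →ₗ[ℂ] (TreeVertex →₀ ℂ) where
  toFun φ := Finsupp.ofSupportFinite ((φ : TreeL2) : TreeVertex → ℂ) φ.2
  map_add' φ ψ := by ext v; rfl
  map_smul' c φ := by ext v; rfl

/-- The operator `T` with domain `𝓓`: `T φ = ∑_w φ_w T δ_w`. -/
def treeOperatorCore (α : ℝ) (t : TreeVertex → ℝ) : TreeL2 →ₗ.[ℂ] TreeL2 where
  domain := finSuppVectors
  toFun := Finsupp.linearCombination ℂ (treeColumn α t) ∘ₗ finSuppCoords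

/-- The operator `T`: the closure of its restriction to `𝓓`. -/
def treeOperator (α : ℝ) (t : TreeVertex → ℝ) : TreeL2 →ₗ.[ℂ] TreeL2 :=
  (treeOperatorCore α t).closure

/-! ### Resolvents -/

/-- The bounded operator `R` is the two-sided inverse of `A - z I : D(A) → H`. -/
def IsResolventAt {H : Type*} [NormedAddCommGroup H] [InnerProductSpace ℂ H]
    (A : H →ₗ.[ℂ] H) (z : ℂ) (R : H →L[ℂ] H) : Prop :=
  (∀ x : A.domain, R (A x - z • (x : H)) = x) ∧
    ∀ y : H, ∃ x : A.domain, (x : H) = R y ∧ A x - z • (x : H) = y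

theorem IsResolventAt.unique {H : Type*} [NormedAddCommGroup H] [InnerProductSpace ℂ H]
    {A : H →ₗ.[ℂ] H} {z : ℂ} {R R' : H →L[ℂ] H} (h : IsResolventAt A z R)
    (h' : IsResolventAt A z R') : R = R' := by
  ext y
  obtain ⟨x, hx, hxy⟩ := h.2 y
  rw [← hx, ← hxy, h'.1 x]

open Classical in
/-- The resolvent `(A - z I)⁻¹` (with value `0` where it does not exist as a bounded
operator). -/
def resolventOp {H : Type*} [NormedAddCommGroup H] [InnerProductSpace ℂ H]
    (A : H →ₗ.[ℂ] H) (z : ℂ) : H →L[ℂ] H :=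
  if h : ∃ R, IsResolventAt A z R then h.choose else 0

/-- `h(z) = ⟨δ_∅, (T - z I)⁻¹ δ_∅⟩`. -/
def rootResolvent (α : ℝ) (t : TreeVertex → ℝ) (z : ℂ) : ℂ :=
  inner ℂ (treeDelta []) (resolventOp (treeOperator α t) z (treeDelta []))

/-- The measure `(α/2) x^{-α/2-1} dx` on `(0, ∞)`. -/
def stableIntensity (α : ℝ) : Measure ℝ :=
  (volume.restrict (Ioi 0)).withDensity fun x => ENNReal.ofReal (α / 2 * x ^ (-(α / 2) - 1))

end

/-! Removing the root splits the tree into the subtrees below its children. These are i.i.d. copies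
of the whole tree, independent of the marks at the root. The Schur complement formula
(`GoodMarks.rootResolvent_recursion`) gives h(z) = -(z + ∑ₖ wₖ² hₖ)⁻¹, with wₖ the edge weights at
the root and hₖ the subtree resolvents. The map t ↦ |t|^(-2/α) sends ℓ_θ to the stable intensity for
every θ (`map_twoSidedLebesgue`), so the wₖ² form the required Poisson process. Three points need
work.

Self-adjointness. Suppose finite parent-closed sets S exhaust V, and the outgoing squared weights of
each vertex of S sum to at most κ, uniformly. Then a deficiency vector ψ satisfies |Im z| ‖ψ_S‖ ≤ √κ
‖ψ - ψ_S‖, hence vanishes. Such S are built from clusters of edges followed by a mark too small for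
its position. A vertex has at most 4/9 such edges on average, so clusters are subcritical branching
trees, almost surely finite (`IsPWIT.ae_hasFiniteClusters`).

Measurability and uniqueness of the law. Root resolvents of trees truncated at depth n obey an
explicit measurable recursion and converge to h(z). Hence h(z) is measurable up to a null set, and
all PWITs give it the same law.

Independence of the enumeration. The wₖ² come ordered by their marks, while ξ is enumerated
arbitrarily. Given the points, the characteristic function of ∑ₖ g(ξₖ) hₖ is a product over points;
for a step function g it depends only on the counts in disjoint cells. Discretising the identity
shows that the law of ∑ₖ ξₖ hₖ depends only on the intensity and the mark law
(`IsMarkedPoisson.identDistrib_tsum`).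

The symmetry under z ↦ -z̄ reflects that a tree is bipartite. -/

noncomputable section

/-! ### Symmetric operators with vanishing deficiency spaces -/

section SymmetricOperator

variable {H : Type*} [NormedAddCommGroup H] [InnerProductSpace ℂ H] {T : H →ₗ.[ℂ] H}

/-- ⟨x, T x⟩ is real, so ⟨x, (T - z) x⟩ has imaginary part -Im z ‖x‖²; then Cauchy–Schwarz. -/
theorem LinearPMap.IsFormalAdjoint.norm_le (hs : T.IsFormalAdjoint T) (z : ℂ) (x : T.domain) :
    |z.im| * ‖(x : H)‖ ≤ ‖T x - z • (x : H)‖ := by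
  have h1 : (inner ℂ (x : H) (T x)).im = 0 := by
    have h := hs x x
    rw [← inner_conj_symm] at h
    have := congrArg Complex.im h
    rw [Complex.conj_im] at this
    linarith
  have h2 : (inner ℂ (x : H) (T x - z • (x : H))).im = - (z.im * ‖(x : H)‖ ^ 2) := by
    rw [inner_sub_right, inner_smul_right, inner_self_eq_norm_sq_to_K, Complex.sub_im, h1]
    simp [← Complex.ofReal_pow]
  rcases eq_or_ne (‖(x : H)‖) 0 with h0 | h0
  · rw [h0]; simp
  have h3 : |z.im| * ‖(x : H)‖ ^ 2 ≤ ‖(x : H)‖ * ‖T x - z • (x : H)‖ := by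
    calc |z.im| * ‖(x : H)‖ ^ 2 = |(inner ℂ (x : H) (T x - z • (x : H))).im| := by
          rw [h2, abs_neg, abs_mul, abs_of_nonneg (sq_nonneg ‖(x : H)‖)]
      _ ≤ ‖inner ℂ (x : H) (T x - z • (x : H))‖ := Complex.abs_im_le_norm _
      _ ≤ _ := norm_inner_le_norm _ _
  have hpos : 0 < ‖(x : H)‖ := lt_of_le_of_ne (norm_nonneg _) h0.symm
  nlinarith

/-- The deficiency space of `T` at `z` vanishes. -/
def NoDeficiency (T : H →ₗ.[ℂ] H) (z : ℂ) : Prop :=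
  ∀ ψ : H, (∀ x : T.domain, inner ℂ ψ (T x - z • (x : H)) = 0) → ψ = 0

variable [CompleteSpace H]

theorem LinearPMap.IsFormalAdjoint.isClosable (hT : Dense (T.domain : Set H))
    (hs : T.IsFormalAdjoint T) : T.IsClosable :=
  (LinearPMap.adjoint_isClosed hT).isClosable.leIsClosable (hs.le_adjoint hT)

/-- The adjoint is closed and extends `T`, hence extends the closure. This gives the identity
against the graph of `T`, and it passes to limits. -/
theorem LinearPMap.IsFormalAdjoint.closure (hT : Dense (T.domain : Set H))
    (hs : T.IsFormalAdjoint T) : T.closure.IsFormalAdjoint T.closure := by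
  have hc := hs.isClosable hT
  have hle : T.closure ≤ T.adjoint := by
    have h := (LinearPMap.adjoint_isClosed hT).isClosable.closure_mono (hs.le_adjoint hT)
    have h2 : T.adjoint.closure = T.adjoint := by
      apply LinearPMap.eq_of_eq_graph
      rw [← (LinearPMap.adjoint_isClosed hT).isClosable.graph_closure_eq_closure_graph]
      exact IsClosed.submodule_topologicalClosure_eq (LinearPMap.adjoint_isClosed hT)
    rwa [h2] at h
  intro x y
  have key : ∀ p ∈ T.closure.graph, inner ℂ (T.closure x) p.1 = inner ℂ (x : H) p.2 := by
    have hcl : _root_.IsClosed {p : H × H | inner ℂ (T.closure x) p.1 = inner ℂ (x : H) p.2} :=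
      isClosed_eq (by fun_prop) (by fun_prop)
    have hsub : (T.graph : Set (H × H)) ⊆
        {p : H × H | inner ℂ (T.closure x) p.1 = inner ℂ (x : H) p.2} := by
      rintro p hp
      obtain ⟨q, hq1, hq2⟩ := (LinearPMap.mem_graph_iff T).1 hp
      have hx : T.closure x = T.adjoint ⟨x, hle.1 x.2⟩ := hle.2 rfl
      change inner ℂ (T.closure x) p.1 = inner ℂ (x : H) p.2
      rw [hx, ← hq1, ← hq2]
      exact LinearPMap.adjoint_isFormalAdjoint hT ⟨x, hle.1 x.2⟩ q
    intro p hp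
    rw [← hc.graph_closure_eq_closure_graph] at hp
    exact closure_minimal hsub hcl hp
  exact key (y, T.closure y) (LinearPMap.mem_graph _ y)

/-- On the complete graph of the closure A, the map (x, A x) ↦ A x - z x is bounded below, so its
range is closed; vanishing deficiency makes the range dense. The resolvent is the first coordinate
of the inverse. -/
theorem exists_isResolventAt (hT : Dense (T.domain : Set H)) (hs : T.IsFormalAdjoint T)
    {z : ℂ} (hz : z.im ≠ 0) (hd : NoDeficiency T z) : ∃ R, IsResolventAt T.closure z R := by
  have hc := hs.isClosable hT
  have hsc := hs.closure hT
  set A := T.closure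
  have : CompleteSpace A.graph := (hc.closure_isClosed : IsClosed _).completeSpace_coe
  let e₀ : A.graph →L[ℂ] H :=
    (ContinuousLinearMap.snd ℂ H H - z • ContinuousLinearMap.fst ℂ H H).comp A.graph.subtypeL
  have he₀ : ∀ p : A.graph, e₀ p = (p : H × H).2 - z • (p : H × H).1 := fun p => rfl
  have hzpos : 0 < |z.im| := abs_pos.2 hz
  have hbound : ∀ p : A.graph, ‖p‖ ≤ (1 + (1 + ‖z‖) / |z.im|) * ‖e₀ p‖ := by
    intro p
    obtain ⟨x, hx1, hx2⟩ := (LinearPMap.mem_graph_iff A).1 p.2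
    have h := hsc.norm_le z x
    rw [he₀, ← hx1, ← hx2]
    have h1 : ‖(x : H)‖ ≤ 1 / |z.im| * ‖A x - z • (x : H)‖ := by
      rw [div_mul_eq_mul_div, one_mul, le_div_iff₀ hzpos]; linarith
    have h2 : ‖A x‖ ≤ ‖A x - z • (x : H)‖ + ‖z‖ * ‖(x : H)‖ := by
      calc ‖A x‖ = ‖(A x - z • (x : H)) + z • (x : H)‖ := by rw [sub_add_cancel]
        _ ≤ _ := (norm_add_le _ _).trans_eq (by rw [norm_smul])
    have h3 : ‖p‖ = max ‖(x : H)‖ ‖A x‖ := by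
      rw [hx1, hx2]; rfl
    rw [h3]
    have h4 : ‖z‖ * ‖(x : H)‖ ≤ ‖z‖ * (1 / |z.im| * ‖A x - z • (x : H)‖) := by gcongr
    have h5 : (1 + (1 + ‖z‖) / |z.im|) * ‖A x - z • (x : H)‖ = ‖A x - z • (x : H)‖
        + 1 / |z.im| * ‖A x - z • (x : H)‖ + ‖z‖ * (1 / |z.im| * ‖A x - z • (x : H)‖) := by ring
    have h6 : 0 ≤ ‖z‖ * (1 / |z.im| * ‖A x - z • (x : H)‖) := by positivity
    have h7 : 0 ≤ 1 / |z.im| * ‖A x - z • (x : H)‖ := by positivity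
    have h8 := norm_nonneg (A x - z • (x : H))
    rw [h5]
    exact max_le (by linarith) (by linarith)
  have hanti : AntilipschitzWith (Real.toNNReal (1 + (1 + ‖z‖) / |z.im|)) e₀ := by
    apply AddMonoidHomClass.antilipschitz_of_bound
    intro p
    rw [Real.coe_toNNReal _ (by positivity)]
    exact hbound p
  have hker : LinearMap.ker (e₀ : A.graph →ₗ[ℂ] H) = ⊥ := LinearMap.ker_eq_bot.2 hanti.injective
  have hrange : LinearMap.range (e₀ : A.graph →ₗ[ℂ] H) = ⊤ := by
    have hclosed : IsClosed (LinearMap.range (e₀ : A.graph →ₗ[ℂ] H) : Set H) := by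
      have := hanti.isClosed_range e₀.uniformContinuous
      rwa [LinearMap.coe_range]
    rw [← IsClosed.submodule_topologicalClosure_eq hclosed,
      Submodule.topologicalClosure_eq_top_iff, Submodule.eq_bot_iff]
    intro ψ hψ
    apply hd
    intro x
    have hmem : ((x : H), T x) ∈ A.graph :=
      LinearPMap.le_graph_of_le (LinearPMap.le_closure T) (LinearPMap.mem_graph T x)
    have := (Submodule.mem_orthogonal' _ _).1 hψ (e₀ ⟨_, hmem⟩) ⟨_, rfl⟩
    rwa [he₀] at this
  let e := ContinuousLinearEquiv.ofBijective e₀ hker hrange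
  have he : ∀ p, e p = (p : H × H).2 - z • (p : H × H).1 := fun p => he₀ p
  refine ⟨(ContinuousLinearMap.fst ℂ H H).comp (A.graph.subtypeL.comp
    (e.symm : H →L[ℂ] A.graph)), ?_, ?_⟩
  · intro x
    have : A x - z • (x : H) = e ⟨_, LinearPMap.mem_graph A x⟩ := by rw [he]
    rw [this]
    simp
  · intro y
    obtain ⟨x, hx1, hx2⟩ := (LinearPMap.mem_graph_iff A).1 (e.symm y).2
    refine ⟨x, hx1, ?_⟩
    have := he (e.symm y)
    rw [e.apply_symm_apply] at this
    rw [hx1, hx2]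
    exact this.symm

/-- For φ in the domain of the adjoint A* of the closure A, solve (A - i) x = (A* - i) φ. Then φ - x
lies in the deficiency space at the conjugate of i, so φ = x. -/
theorem isSelfAdjoint_closure (hT : Dense (T.domain : Set H)) (hs : T.IsFormalAdjoint T)
    (hd : ∀ z : ℂ, z.im ≠ 0 → NoDeficiency T z) : IsSelfAdjoint T.closure := by
  have hsc := hs.closure hT
  have hTc : T ≤ T.closure := LinearPMap.le_closure T
  have hdense : Dense (T.closure.domain : Set H) := hT.mono hTc.1
  rw [LinearPMap.isSelfAdjoint_def]
  have hle := hsc.le_adjoint hdense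
  symm
  apply LinearPMap.eq_of_le_of_domain_eq hle
  apply le_antisymm hle.1
  intro φ hφ
  obtain ⟨R, -, hR⟩ := exists_isResolventAt hT hs (z := Complex.I) (by simp) (hd _ (by simp))
  obtain ⟨x, -, hx⟩ := hR (T.closure.adjoint ⟨φ, hφ⟩ - Complex.I • φ)
  have : φ - x = 0 := by
    apply hd (conj Complex.I) (by simp)
    intro y
    have hy : T y = T.closure ⟨y, hTc.1 y.2⟩ := hTc.2 rfl
    have h1 := LinearPMap.adjoint_isFormalAdjoint hdense ⟨φ, hφ⟩ ⟨y, hTc.1 y.2⟩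
    have h2 := hsc x ⟨y, hTc.1 y.2⟩
    simp only at h1 h2
    have h3 := congrArg (fun w => inner ℂ w (y : H)) hx
    simp only [inner_sub_left, inner_smul_left] at h3
    rw [inner_sub_left, inner_sub_right, inner_sub_right, inner_smul_right, inner_smul_right,
      hy, ← h1, ← h2]
    linear_combination -h3
  rw [sub_eq_zero.1 this]
  exact x.2

end SymmetricOperator

/-! ### The tree operator on finitely supported vectors -/

section TreeOperator

variable {α : ℝ} {t : TreeVertex → ℝ}

theorem treeEntry_symm (v w : TreeVertex) : treeEntry α t v w = treeEntry α t w v := by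
  unfold treeEntry
  by_cases h1 : ∃ k, w = v ++ [k]
  · have h2 : ¬ ∃ k, v = w ++ [k] := by
      rintro ⟨k, hk⟩
      obtain ⟨j, hj⟩ := h1
      have := congrArg List.length hk
      have := congrArg List.length hj
      simp at *
      omega
    rw [if_pos h1, if_neg h2, if_pos h1]
  · rw [if_neg h1]
    split_ifs <;> rfl

theorem treeEntry_child (v : TreeVertex) (k : ℕ) :
    treeEntry α t v (v ++ [k]) = edgeWeight α (t (v ++ [k])) :=
  if_pos ⟨k, rfl⟩

theorem treeEntry_child' (v : TreeVertex) (k : ℕ) :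
    treeEntry α t (v ++ [k]) v = edgeWeight α (t (v ++ [k])) := by
  rw [treeEntry_symm, treeEntry_child]

theorem exists_of_treeEntry_ne_zero {v w : TreeVertex} (h : treeEntry α t v w ≠ 0) :
    (∃ k, w = v ++ [k]) ∨ ∃ k, v = w ++ [k] := by
  unfold treeEntry at h
  by_contra! hc
  rw [if_neg (by push Not; exact hc.1), if_neg (by push Not; exact hc.2)] at h
  exact h rfl

theorem treeColumn_apply (hc : TreeColumnsSquareSummable α t) (v w : TreeVertex) :
    treeColumn α t w v = (treeEntry α t v w : ℂ) := by
  unfold treeColumn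
  rw [dif_pos (hc w)]

theorem inner_treeDelta_left (v : TreeVertex) (ψ : TreeL2) : inner ℂ (treeDelta v) ψ = ψ v := by
  rw [treeDelta, lp.inner_single_left]; simp

theorem inner_treeDelta_right (v : TreeVertex) (ψ : TreeL2) :
    inner ℂ ψ (treeDelta v) = conj (ψ v) := by
  rw [← inner_conj_symm, inner_treeDelta_left]

theorem treeDelta_apply (v w : TreeVertex) : treeDelta v w = if w = v then 1 else 0 := by
  rw [treeDelta]
  split_ifs with h
  · rw [h]; exact lp.single_apply_self 2 v 1
  · exact lp.single_apply_ne 2 v 1 h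

theorem treeDelta_mem (v : TreeVertex) : treeDelta v ∈ finSuppVectors := by
  refine (Set.finite_singleton v).subset fun w hw => ?_
  by_contra h
  exact hw (by rw [treeDelta_apply, if_neg (by simpa using h)])

theorem single_eq_smul_treeDelta (v : TreeVertex) (c : ℂ) :
    (lp.single 2 v c : TreeL2) = c • treeDelta v := by
  rw [treeDelta, ← lp.single_smul]; simp

theorem treeOperatorCore_apply (φ : (treeOperatorCore α t).domain) :
    treeOperatorCore α t φ =
      ∑ w ∈ (φ.2 : (Function.support (φ.1 : TreeVertex → ℂ)).Finite).toFinset,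
      (φ : TreeL2) w • treeColumn α t w := by
  change Finsupp.linearCombination ℂ (treeColumn α t) (finSuppCoords φ) = _
  rw [Finsupp.linearCombination_apply, Finsupp.sum]
  rfl

theorem treeOperatorCore_treeDelta (v : TreeVertex) :
    treeOperatorCore α t ⟨treeDelta v, treeDelta_mem v⟩ = treeColumn α t v := by
  rw [treeOperatorCore_apply, Finset.sum_eq_single v]
  · simp [treeDelta_apply]
  · intro w _ hw
    simp [treeDelta_apply, hw]
  · intro h
    exact absurd ((Set.Finite.mem_toFinset _).2 (by simp [treeDelta_apply])) h

theorem inner_treeOperatorCore (φ : (treeOperatorCore α t).domain) (ψ : TreeL2) :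
    inner ℂ (treeOperatorCore α t φ) ψ =
      ∑ w ∈ (φ.2 : (Function.support (φ.1 : TreeVertex → ℂ)).Finite).toFinset,
        conj ((φ : TreeL2) w) * inner ℂ (treeColumn α t w) ψ := by
  rw [treeOperatorCore_apply, sum_inner]
  simp only [inner_smul_left]

theorem inner_finSupp (φ : (treeOperatorCore α t).domain) (ψ : TreeL2) :
    inner ℂ (φ : TreeL2) ψ =
      ∑ w ∈ (φ.2 : (Function.support (φ.1 : TreeVertex → ℂ)).Finite).toFinset,
        conj ((φ : TreeL2) w) * ψ w := by
  rw [lp.inner_eq_tsum, tsum_eq_sum (s := (φ.2 :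
    (Function.support (φ.1 : TreeVertex → ℂ)).Finite).toFinset)]
  · simp [mul_comm]
  · intro w hw
    have : (φ : TreeL2) w = 0 := by
      by_contra h0
      exact hw ((Set.Finite.mem_toFinset _).2 h0)
    simp [this]

theorem inner_treeColumn (hc : TreeColumnsSquareSummable α t) (v : TreeVertex) (ψ : TreeL2) :
    HasSum (fun u => (treeEntry α t v u : ℂ) * ψ u) (inner ℂ (treeColumn α t v) ψ) := by
  have h := lp.hasSum_inner (𝕜 := ℂ) (treeColumn α t v) ψ
  have hfun : (fun u => inner ℂ (treeColumn α t v u) (ψ u)) =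
      fun u => (treeEntry α t v u : ℂ) * ψ u := by
    funext u
    rw [treeColumn_apply hc, treeEntry_symm, RCLike.inner_apply, mul_comm, Complex.conj_ofReal]
  rwa [hfun] at h

theorem treeOperatorCore_coord (hc : TreeColumnsSquareSummable α t)
    (φ : (treeOperatorCore α t).domain) (v : TreeVertex) :
    treeOperatorCore α t φ v = inner ℂ (treeColumn α t v) (φ : TreeL2) := by
  rw [← inner_conj_symm, inner_finSupp, ← inner_treeDelta_left, ← inner_conj_symm,
    inner_treeOperatorCore]
  congr 1
  refine Finset.sum_congr rfl fun w _ => ?_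
  rw [inner_treeDelta_right, treeColumn_apply hc, treeColumn_apply hc, treeEntry_symm,
    Complex.conj_ofReal]

theorem treeOperatorCore_isFormalAdjoint (hc : TreeColumnsSquareSummable α t) :
    (treeOperatorCore α t).IsFormalAdjoint (treeOperatorCore α t) := by
  intro φ χ
  rw [inner_treeOperatorCore, inner_finSupp]
  refine Finset.sum_congr rfl fun w _ => ?_
  rw [treeOperatorCore_coord hc]

theorem dense_treeOperatorCore_domain :
    Dense ((treeOperatorCore α t).domain : Set TreeL2) := by
  intro ψ
  have h := lp.hasSum_single (E := fun _ : TreeVertex => ℂ) (p := 2) (by simp) ψ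
  refine mem_closure_of_tendsto h (Eventually.of_forall fun S => ?_)
  refine Submodule.sum_mem _ fun v _ => ?_
  rw [single_eq_smul_treeDelta]
  exact Submodule.smul_mem _ _ (treeDelta_mem v)

/-! ### Confined marks -/

/-- The vertex set is exhausted by finite subtrees whose outgoing weights are bounded in `ℓ²`,
uniformly in the vertices of the subtree. -/
def TreeConfined (α : ℝ) (t : TreeVertex → ℝ) : Prop :=
  ∃ κ : ℝ, ∀ F : Finset TreeVertex, ∃ S : Finset TreeVertex, F ⊆ S ∧
    (∀ v k, v ++ [k] ∈ S → v ∈ S) ∧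
    ∀ v ∈ S, ∑' u, (if u ∈ S then 0 else treeEntry α t u v ^ 2) ≤ κ

/-- The marks for which the operator is self-adjoint by the exhaustion criterion. -/
structure GoodMarks (α : ℝ) (t : TreeVertex → ℝ) : Prop where
  columns : TreeColumnsSquareSummable α t
  confined : TreeConfined α t

theorem treeColumnsSquareSummable_iff : TreeColumnsSquareSummable α t ↔
    ∀ w, Summable fun v => treeEntry α t v w ^ 2 := by
  unfold TreeColumnsSquareSummable
  refine forall_congr' fun w => ?_
  rw [memℓp_gen_iff (by simp)]
  simp

/-- Serves for truncations: the same exhausting sets and the same κ work. -/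
theorem GoodMarks.of_abs_le {t' : TreeVertex → ℝ} (h : GoodMarks α t)
    (hle : ∀ v w, |treeEntry α t' v w| ≤ |treeEntry α t v w|) : GoodMarks α t' := by
  have hsq : ∀ v w, treeEntry α t' v w ^ 2 ≤ treeEntry α t v w ^ 2 := fun v w =>
    sq_le_sq.2 (hle v w)
  have hc := treeColumnsSquareSummable_iff.1 h.columns
  have hc' : ∀ w, Summable fun v => treeEntry α t' v w ^ 2 := fun w =>
    (hc w).of_nonneg_of_le (fun v => sq_nonneg _) fun v => hsq v w
  refine ⟨treeColumnsSquareSummable_iff.2 hc', ?_⟩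
  obtain ⟨κ, hκ⟩ := h.confined
  refine ⟨κ, fun F => ?_⟩
  obtain ⟨S, hFS, hS, hb⟩ := hκ F
  refine ⟨S, hFS, hS, fun v hv => le_trans ?_ (hb v hv)⟩
  have aux : ∀ s : TreeVertex → ℝ, (∀ u, 0 ≤ s u) → Summable s →
      Summable fun u => if u ∈ S then 0 else s u := fun s h0 hs =>
    hs.of_nonneg_of_le (fun u => by split_ifs; exacts [le_rfl, h0 u])
      (fun u => by split_ifs; exacts [h0 u, le_rfl])
  refine Summable.tsum_le_tsum (fun u => ?_) (aux _ (fun u => sq_nonneg _) (hc' v))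
    (aux _ (fun u => sq_nonneg _) (hc v))
  split_ifs
  exacts [le_rfl, hsq u v]

/-- The part of the column at `v` outside of `S`. -/
def outerColumn (α : ℝ) (t : TreeVertex → ℝ) (S : Finset TreeVertex) (v : TreeVertex) : TreeL2 :=
  treeColumn α t v - ∑ u ∈ S, treeColumn α t v u • treeDelta u

theorem outerColumn_apply (hc : TreeColumnsSquareSummable α t) (S : Finset TreeVertex)
    (v u : TreeVertex) :
    outerColumn α t S v u = if u ∈ S then 0 else (treeEntry α t u v : ℂ) := by
  have : (∑ u ∈ S, treeColumn α t v u • treeDelta u : TreeL2) u =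
      if u ∈ S then treeColumn α t v u else 0 := by
    rw [lp.coeFn_sum, Finset.sum_apply]
    simp [treeDelta_apply]
  rw [outerColumn, lp.coeFn_sub, Pi.sub_apply, this, treeColumn_apply hc]
  split_ifs <;> simp

/-- Since `S` contains parents, a vertex outside `S` adjacent to `S` is the child of exactly one
vertex of `S`. The outer columns therefore have disjoint supports, and Pythagoras applies. -/
theorem norm_sq_sum_outerColumn_le (hc : TreeColumnsSquareSummable α t) {S : Finset TreeVertex}
    {κ : ℝ} (hS : ∀ v k, v ++ [k] ∈ S → v ∈ S)
    (hb : ∀ v ∈ S, ∑' u, (if u ∈ S then 0 else treeEntry α t u v ^ 2) ≤ κ)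
    (c : TreeVertex → ℂ) :
    ‖∑ v ∈ S, c v • outerColumn α t S v‖ ^ 2 ≤ κ * ∑ v ∈ S, ‖c v‖ ^ 2 := by
  have horth : ∀ v ∈ S, ∀ w ∈ S, v ≠ w →
      inner ℂ (outerColumn α t S v) (outerColumn α t S w) = 0 := by
    intro v hv w hw hvw
    rw [lp.inner_eq_tsum]
    convert tsum_zero with u
    rw [outerColumn_apply hc, outerColumn_apply hc]
    by_cases hu : u ∈ S
    · simp [hu]
    rw [if_neg hu, if_neg hu]
    have child : ∀ x ∈ S, treeEntry α t u x ≠ 0 → ∃ k, u = x ++ [k] := by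
      intro x hx hne
      rcases exists_of_treeEntry_ne_zero hne with ⟨k, hk⟩ | h
      · exact absurd (hS u k (hk ▸ hx)) hu
      · exact h
    by_cases h1 : treeEntry α t u v = 0
    · simp [h1]
    by_cases h2 : treeEntry α t u w = 0
    · simp [h2]
    obtain ⟨k, hk⟩ := child v hv h1
    obtain ⟨j, hj⟩ := child w hw h2
    exact absurd (List.append_inj' (hk.symm.trans hj) rfl).1 hvw
  have hnorm : ∀ v ∈ S, ‖outerColumn α t S v‖ ^ 2 ≤ κ := by
    intro v hv
    refine le_trans (le_of_eq ?_) (hb v hv)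
    have h := lp.norm_rpow_eq_tsum (p := 2) (by simp) (outerColumn α t S v)
    simp only [ENNReal.toReal_ofNat, Real.rpow_ofNat] at h
    rw [h]
    refine tsum_congr fun u => ?_
    rw [outerColumn_apply hc]
    split_ifs <;> simp
  have hexp : inner ℂ (∑ v ∈ S, c v • outerColumn α t S v) (∑ v ∈ S, c v • outerColumn α t S v) =
      ∑ v ∈ S, ((‖c v‖ ^ 2 * ‖outerColumn α t S v‖ ^ 2 : ℝ) : ℂ) := by
    rw [sum_inner]
    refine Finset.sum_congr rfl fun v hv => ?_
    rw [inner_sum, Finset.sum_eq_single v]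
    · rw [inner_smul_left, inner_smul_right, inner_self_eq_norm_sq_to_K, ← mul_assoc,
        Complex.conj_mul']
      push_cast
      rfl
    · intro w hw hwv
      rw [inner_smul_left, inner_smul_right, horth v hv w hw hwv.symm]
      simp
    · exact fun h => absurd hv h
  rw [inner_self_eq_norm_sq_to_K] at hexp
  have : ‖∑ v ∈ S, c v • outerColumn α t S v‖ ^ 2 =
      ∑ v ∈ S, ‖c v‖ ^ 2 * ‖outerColumn α t S v‖ ^ 2 := by
    apply Complex.ofReal_injective
    push_cast at hexp ⊢
    exact hexp
  rw [this, Finset.mul_sum]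
  refine Finset.sum_le_sum fun v hv => ?_
  rw [mul_comm]
  exact mul_le_mul_of_nonneg_right (hnorm v hv) (sq_nonneg _)

theorem im_sum_treeEntry (S : Finset TreeVertex) (c : TreeVertex → ℂ) :
    (∑ v ∈ S, ∑ w ∈ S, conj (c v) * (treeEntry α t v w * c w)).im = 0 := by
  rw [← Complex.conj_eq_iff_im]
  simp only [map_sum, map_mul, Complex.conj_conj, Complex.conj_ofReal]
  rw [Finset.sum_comm]
  refine Finset.sum_congr rfl fun v _ => Finset.sum_congr rfl fun w _ => ?_
  rw [treeEntry_symm]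
  ring

/-- Let φ be the restriction of ψ to `S`. Then ⟨Tφ, ψ⟩ = z ‖φ‖² while ⟨Tφ, φ⟩ is real, so Im z ‖φ‖²
is the imaginary part of ⟨Tφ, ψ - φ⟩, which only sees the edges leaving `S`. -/
theorem norm_restrict_le (hc : TreeColumnsSquareSummable α t) {S : Finset TreeVertex}
    {κ : ℝ} (hS : ∀ v k, v ++ [k] ∈ S → v ∈ S)
    (hb : ∀ v ∈ S, ∑' u, (if u ∈ S then 0 else treeEntry α t u v ^ 2) ≤ κ)
    {z : ℂ} {ψ : TreeL2} (hψ : ∀ v, inner ℂ (treeColumn α t v) ψ = z * ψ v) :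
    |z.im| * ‖∑ v ∈ S, (lp.single 2 v (ψ v) : TreeL2)‖ ≤
      √κ * ‖ψ - ∑ v ∈ S, (lp.single 2 v (ψ v) : TreeL2)‖ := by
  set φ : TreeL2 := ∑ v ∈ S, (lp.single 2 v (ψ v) : TreeL2) with hφ
  have hφ' : φ = ∑ v ∈ S, ψ v • treeDelta v :=
    Finset.sum_congr rfl fun v _ => single_eq_smul_treeDelta v _
  have hφv : ∀ u, φ u = if u ∈ S then ψ u else 0 := by
    intro u
    rw [hφ', lp.coeFn_sum, Finset.sum_apply]
    simp [treeDelta_apply]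
  have hnφ : ‖φ‖ ^ 2 = ∑ v ∈ S, ‖ψ v‖ ^ 2 := by
    have := lp.norm_sum_single (p := 2) (by simp) (fun v => ψ v) S
    simpa using this
  set C : TreeL2 := ∑ v ∈ S, ψ v • treeColumn α t v
  set B : TreeL2 := ∑ v ∈ S, ψ v • outerColumn α t S v
  have hB : ‖B‖ ≤ √κ * ‖φ‖ := by
    have h := norm_sq_sum_outerColumn_le hc hS hb (fun v => ψ v)
    rw [← hnφ] at h
    have := Real.sqrt_le_sqrt h
    rwa [Real.sqrt_sq (norm_nonneg _), Real.sqrt_mul' _ (sq_nonneg _),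
      Real.sqrt_sq (norm_nonneg _)] at this
  have h1 : inner ℂ C ψ = z * (‖φ‖ ^ 2 : ℝ) := by
    rw [sum_inner, hnφ]
    push_cast
    rw [Finset.mul_sum]
    refine Finset.sum_congr rfl fun v _ => ?_
    rw [inner_smul_left, hψ, ← Complex.conj_mul']
    ring
  have h2 : (inner ℂ C φ).im = 0 := by
    rw [← im_sum_treeEntry (α := α) (t := t) S (fun v => ψ v)]
    congr 1
    rw [sum_inner]
    refine Finset.sum_congr rfl fun v _ => ?_
    rw [inner_smul_left, hφ', inner_sum, Finset.mul_sum]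
    refine Finset.sum_congr rfl fun w _ => ?_
    rw [inner_smul_right, inner_treeDelta_right, treeColumn_apply hc, treeEntry_symm,
      Complex.conj_ofReal]
    ring
  have h3 : inner ℂ C (ψ - φ) = inner ℂ B (ψ - φ) := by
    rw [lp.inner_eq_tsum, lp.inner_eq_tsum]
    refine tsum_congr fun u => ?_
    by_cases hu : u ∈ S
    · have : (ψ - φ) u = 0 := by rw [lp.coeFn_sub, Pi.sub_apply, hφv, if_pos hu, sub_self]
      rw [this, inner_zero_right, inner_zero_right]
    · congr 1
      rw [lp.coeFn_sum, lp.coeFn_sum, Finset.sum_apply, Finset.sum_apply]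
      refine Finset.sum_congr rfl fun v _ => ?_
      rw [lp.coeFn_smul, lp.coeFn_smul, Pi.smul_apply, Pi.smul_apply, outerColumn_apply hc,
        if_neg hu, treeColumn_apply hc]
  have h4 : |z.im| * ‖φ‖ ^ 2 ≤ (√κ * ‖φ‖) * ‖ψ - φ‖ := by
    have : (inner ℂ B (ψ - φ)).im = z.im * ‖φ‖ ^ 2 := by
      rw [← h3, inner_sub_right, Complex.sub_im, h1, h2, Complex.im_mul_ofReal, sub_zero]
    calc |z.im| * ‖φ‖ ^ 2 = |(inner ℂ B (ψ - φ)).im| := by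
          rw [this, abs_mul, abs_of_nonneg (sq_nonneg ‖φ‖)]
      _ ≤ ‖inner ℂ B (ψ - φ)‖ := Complex.abs_im_le_norm _
      _ ≤ ‖B‖ * ‖ψ - φ‖ := norm_inner_le_norm _ _
      _ ≤ _ := by gcongr
  rcases eq_or_ne ‖φ‖ 0 with h0 | h0
  · rw [h0, mul_zero]; positivity
  · have hpos : 0 < ‖φ‖ := lt_of_le_of_ne (norm_nonneg _) h0.symm
    nlinarith

theorem GoodMarks.eq_zero_of_inner_treeColumn (h : GoodMarks α t) {z : ℂ} (hz : z.im ≠ 0)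
    {ψ : TreeL2} (hψ : ∀ v, inner ℂ (treeColumn α t v) ψ = z * ψ v) : ψ = 0 := by
  obtain ⟨κ, hκ⟩ := h.confined
  have hsum := lp.hasSum_single (E := fun _ : TreeVertex => ℂ) (p := 2) (by simp) ψ
  have hzpos := abs_pos.2 hz
  by_contra hne
  have hnpos : 0 < ‖ψ‖ := norm_pos_iff.2 hne
  have hden : 0 < |z.im| + √κ + 1 := by positivity
  -- With ‖ψ - φ‖ below this value, |Im z| ‖ψ‖ ≤ (√κ + |Im z|) ‖ψ - φ‖ < |Im z| ‖ψ‖, a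
  -- contradiction.
  have hε : 0 < |z.im| * ‖ψ‖ / (|z.im| + √κ + 1) := by positivity
  obtain ⟨F, hF⟩ := Metric.tendsto_atTop.1 hsum _ hε
  obtain ⟨S, hFS, hS, hb⟩ := hκ F
  have h1 := norm_restrict_le h.columns hS hb hψ
  have h2 := hF S hFS
  rw [dist_comm, dist_eq_norm, lt_div_iff₀ hden] at h2
  set φ : TreeL2 := ∑ v ∈ S, (lp.single 2 v (ψ v) : TreeL2)
  have h3 : ‖ψ‖ ≤ ‖φ‖ + ‖ψ - φ‖ := by
    calc ‖ψ‖ = ‖φ + (ψ - φ)‖ := by rw [add_sub_cancel]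
      _ ≤ _ := norm_add_le _ _
  have h4 : |z.im| * ‖ψ‖ ≤ |z.im| * ‖φ‖ + |z.im| * ‖ψ - φ‖ := by rw [← mul_add]; gcongr
  have h5 := norm_nonneg (ψ - φ)
  nlinarith

theorem GoodMarks.noDeficiency (h : GoodMarks α t) {z : ℂ} (hz : z.im ≠ 0) :
    NoDeficiency (treeOperatorCore α t) z := by
  intro ψ hψ
  refine h.eq_zero_of_inner_treeColumn (z := conj z) (by simpa using hz) fun v => ?_
  have := hψ ⟨treeDelta v, treeDelta_mem v⟩
  rw [treeOperatorCore_treeDelta, inner_sub_right, inner_smul_right, inner_treeDelta_right,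
    sub_eq_zero] at this
  rw [← inner_conj_symm, this]
  simp

theorem GoodMarks.isSelfAdjoint (h : GoodMarks α t) : IsSelfAdjoint (treeOperator α t) :=
  isSelfAdjoint_closure dense_treeOperatorCore_domain
    (treeOperatorCore_isFormalAdjoint h.columns) fun _ hz => h.noDeficiency hz

theorem GoodMarks.isResolventAt (h : GoodMarks α t) {z : ℂ} (hz : z.im ≠ 0) :
    IsResolventAt (treeOperator α t) z (resolventOp (treeOperator α t) z) := by
  have hex := exists_isResolventAt dense_treeOperatorCore_domain
    (treeOperatorCore_isFormalAdjoint h.columns) hz (h.noDeficiency hz)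
  change ∃ R, IsResolventAt (treeOperator α t) z R at hex
  rw [resolventOp, dif_pos hex]
  exact hex.choose_spec

/-! ### The resolvent vector at the root -/

/-- The vector `(T - z)⁻¹ δ_∅`. -/
def rootVector (α : ℝ) (t : TreeVertex → ℝ) (z : ℂ) : TreeL2 :=
  resolventOp (treeOperator α t) z (treeDelta [])

theorem rootResolvent_eq (z : ℂ) : rootResolvent α t z = rootVector α t z [] :=
  inner_treeDelta_left _ _

/-- Symmetry moves the operator onto δ_v, so the resolvent equation can be read coordinatewise
through the columns, although the root vector need not be finitely supported. -/
theorem GoodMarks.rootVector_spec (h : GoodMarks α t) {z : ℂ} (hz : z.im ≠ 0) (v : TreeVertex) :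
    inner ℂ (treeColumn α t v) (rootVector α t z) - z * rootVector α t z v =
      if v = [] then 1 else 0 := by
  obtain ⟨x, hx, hxy⟩ := (h.isResolventAt hz).2 (treeDelta [])
  have hs := (treeOperatorCore_isFormalAdjoint h.columns).closure dense_treeOperatorCore_domain
  have hTc := LinearPMap.le_closure (treeOperatorCore α t)
  have hv : (treeOperatorCore α t).closure ⟨treeDelta v, hTc.1 (treeDelta_mem v)⟩ =
      treeColumn α t v := by
    rw [← treeOperatorCore_treeDelta v]
    exact (hTc.2 rfl).symm
  have h1 := hs ⟨treeDelta v, hTc.1 (treeDelta_mem v)⟩ x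
  rw [hv] at h1
  simp only [inner_treeDelta_left] at h1
  rw [rootVector, ← hx, h1, ← treeDelta_apply, ← hxy]
  rfl

/-- Identifies a resolvent vector from its coordinate equations alone, without checking that it lies
in the domain of the operator. -/
theorem GoodMarks.eq_smul_rootVector (h : GoodMarks α t) {z : ℂ} (hz : z.im ≠ 0) {c : ℂ}
    {ψ : TreeL2} (hψ : ∀ v, inner ℂ (treeColumn α t v) ψ - z * ψ v = if v = [] then c else 0) :
    ψ = c • rootVector α t z := by
  rw [← sub_eq_zero]
  refine h.eq_zero_of_inner_treeColumn hz fun v => ?_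
  have h1 := h.rootVector_spec hz v
  have h2 := hψ v
  rw [inner_sub_right, inner_smul_right, lp.coeFn_sub, Pi.sub_apply, lp.coeFn_smul, Pi.smul_apply,
    smul_eq_mul]
  split_ifs at h1 h2 <;> linear_combination h2 - c * h1

end TreeOperator

/-! ### Resolvent bounds and the recursive structure of the tree -/

section TreeRecursion

variable {α : ℝ} {t : TreeVertex → ℝ}

theorem IsResolventAt.norm_le {H : Type*} [NormedAddCommGroup H] [InnerProductSpace ℂ H]
    {A : H →ₗ.[ℂ] H} (hs : A.IsFormalAdjoint A) {z : ℂ} {R : H →L[ℂ] H}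
    (hR : IsResolventAt A z R) (y : H) : |z.im| * ‖R y‖ ≤ ‖y‖ := by
  obtain ⟨x, hx, hxy⟩ := hR.2 y
  have := hs.norm_le z x
  rwa [hxy, hx] at this

theorem GoodMarks.treeOperator_isFormalAdjoint (h : GoodMarks α t) :
    (treeOperator α t).IsFormalAdjoint (treeOperator α t) :=
  (treeOperatorCore_isFormalAdjoint h.columns).closure dense_treeOperatorCore_domain

theorem GoodMarks.norm_rootVector_le (h : GoodMarks α t) {z : ℂ} (hz : z.im ≠ 0) :
    |z.im| * ‖rootVector α t z‖ ≤ 1 := by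
  refine ((h.isResolventAt hz).norm_le h.treeOperator_isFormalAdjoint (treeDelta [])).trans ?_
  rw [treeDelta, lp.norm_single (by simp)]
  simp

theorem GoodMarks.norm_rootResolvent_le (h : GoodMarks α t) {z : ℂ} (hz : 0 < z.im) :
    ‖rootResolvent α t z‖ ≤ 1 / z.im := by
  rw [rootResolvent_eq, le_div_iff₀ hz, mul_comm]
  have h1 := h.norm_rootVector_le hz.ne'
  rw [abs_of_pos hz] at h1
  have h2 := lp.norm_apply_le_norm (p := 2) (by simp) (rootVector α t z) []
  exact (mul_le_mul_of_nonneg_left h2 hz.le).trans h1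

/-- Imaginary parts of ⟨x, (T - z) x⟩ = ⟨x, δ_∅⟩. The resulting Im h ≥ 0 keeps the denominator of
the recursion nonzero. -/
theorem GoodMarks.im_rootResolvent (h : GoodMarks α t) {z : ℂ} (hz : z.im ≠ 0) :
    (rootResolvent α t z).im = z.im * ‖rootVector α t z‖ ^ 2 := by
  obtain ⟨x, hx, hxy⟩ := (h.isResolventAt hz).2 (treeDelta [])
  have h1 : (inner ℂ (x : TreeL2) (treeOperator α t x)).im = 0 := by
    have h := h.treeOperator_isFormalAdjoint x x
    rw [← inner_conj_symm] at h
    have := congrArg Complex.im h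
    rw [Complex.conj_im] at this
    linarith
  have h2 := congrArg (fun w => (inner ℂ (x : TreeL2) w).im) hxy
  simp only [inner_sub_right, inner_smul_right, inner_self_eq_norm_sq_to_K, Complex.sub_im, h1,
    inner_treeDelta_right, Complex.conj_im] at h2
  rw [rootResolvent_eq, rootVector, ← hx]
  have h3 : (z * ((‖(x : TreeL2)‖ : ℂ) ^ 2)).im = z.im * ‖(x : TreeL2)‖ ^ 2 := by
    rw [← Complex.ofReal_pow, Complex.im_mul_ofReal]
  have h4 : (z * ((‖(x : TreeL2)‖ : ℂ) ^ 2)).im = ((x : TreeL2) []).im := by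
    have : 0 - (z * ((‖(x : TreeL2)‖ : ℂ) ^ 2)).im = -((x : TreeL2) []).im := h2
    linarith
  rw [← h3, h4]

/-! ### Symmetry of the root resolvent -/

/-- The vector with coordinates `-(-1)^|v| conj (ψ v)`. -/
def alternatingConj (ψ : TreeL2) : TreeL2 :=
  ⟨fun v => -((-1) ^ v.length * conj (ψ v)), by
    have := (memℓp_gen_iff (p := 2) (by simp)).1 (lp.memℓp ψ)
    refine (memℓp_gen_iff (p := 2) (by simp)).2 ?_
    simpa using this⟩

/-- Edges join levels of opposite parity and entries are real, so the sign (-1)^|v| turns T into -T.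
The signed conjugate of the root vector at z thus solves the equation at -z̄. -/
theorem GoodMarks.rootResolvent_neg_conj (h : GoodMarks α t) {z : ℂ} (hz : z.im ≠ 0) :
    rootResolvent α t (-conj z) = -conj (rootResolvent α t z) := by
  have happ : ∀ v, alternatingConj (rootVector α t z) v =
    -((-1) ^ v.length * conj (rootVector α t z v)) := fun v => rfl
  have hz' : (-conj z).im ≠ 0 := by simpa using hz
  have key : alternatingConj (rootVector α t z) = (1 : ℂ) • rootVector α t (-conj z) := by
    refine h.eq_smul_rootVector hz' fun v => ?_
    have h1 := (inner_treeColumn h.columns v (alternatingConj (rootVector α t z)))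
    have h2 := (Complex.hasSum_conj'.2 (inner_treeColumn h.columns v (rootVector α t z))).mul_left
      ((-1 : ℂ) ^ v.length)
    have hfun : (fun u => (-1 : ℂ) ^ v.length *
        conj ((treeEntry α t v u : ℂ) * rootVector α t z u)) =
        fun u => (treeEntry α t v u : ℂ) * alternatingConj (rootVector α t z) u := by
      funext u
      rw [happ, map_mul, Complex.conj_ofReal]
      by_cases h0 : treeEntry α t v u = 0
      · simp [h0]
      rcases exists_of_treeEntry_ne_zero h0 with ⟨j, rfl⟩ | ⟨j, rfl⟩ <;>
      · simp only [List.length_append, List.length_singleton, pow_succ]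
        ring
    rw [hfun] at h2
    have h3 := congrArg conj (h.rootVector_spec hz v)
    rw [h1.unique h2, happ]
    rw [map_sub, map_mul] at h3
    split_ifs at h3 ⊢ with hv
    · subst hv
      simp only [map_one] at h3
      simp only [List.length_nil, pow_zero]
      linear_combination h3
    · rw [map_zero] at h3
      linear_combination (-1 : ℂ) ^ v.length * h3
  rw [rootResolvent_eq, rootResolvent_eq, ← one_smul ℂ (rootVector α t (-conj z)), ← key, happ]
  simp

/-! ### Subtrees -/

/-- The marks of the subtree below the child `k` of the root. -/
def subMarks (t : TreeVertex → ℝ) (k : ℕ) : TreeVertex → ℝ := fun v => t (k :: v)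

theorem treeEntry_subMarks (k : ℕ) (v w : TreeVertex) :
    treeEntry α (subMarks t k) v w = treeEntry α t (k :: v) (k :: w) := by
  have hiff : ∀ a b : TreeVertex, (∃ j, a = b ++ [j]) ↔ ∃ j, k :: a = k :: b ++ [j] := fun a b =>
    exists_congr fun j => by simp
  classical exact if_congr (hiff w v) rfl (if_congr (hiff v w) rfl rfl)

theorem treeEntry_cons_nil (k : ℕ) (v : TreeVertex) :
    treeEntry α t (k :: v) [] = if v = [] then edgeWeight α (t [k]) else 0 := by
  split_ifs with h
  · subst h
    exact treeEntry_child' [] k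
  · by_contra h0
    rcases exists_of_treeEntry_ne_zero h0 with ⟨j, hj⟩ | ⟨j, hj⟩ <;> simp at hj
    exact h hj.2

theorem treeEntry_cons_cons_of_ne {j k : ℕ} (hjk : j ≠ k) (v w : TreeVertex) :
    treeEntry α t (k :: v) (j :: w) = 0 := by
  by_contra h0
  rcases exists_of_treeEntry_ne_zero h0 with ⟨i, hi⟩ | ⟨i, hi⟩ <;> simp at hi
  · exact hjk hi.1
  · exact hjk hi.1.symm

theorem GoodMarks.subMarks (h : GoodMarks α t) (k : ℕ) : GoodMarks α (subMarks t k) := by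
  have hinj : Function.Injective (List.cons k) := List.cons_injective
  have hc := treeColumnsSquareSummable_iff.1 h.columns
  refine ⟨treeColumnsSquareSummable_iff.2 fun w => ?_, ?_⟩
  · simp only [treeEntry_subMarks]
    exact (hc (k :: w)).comp_injective hinj
  · obtain ⟨κ, hκ⟩ := h.confined
    refine ⟨κ, fun F => ?_⟩
    obtain ⟨S, hFS, hS, hb⟩ := hκ (F.image (List.cons k))
    refine ⟨S.preimage (List.cons k) hinj.injOn, fun v hv => ?_, fun v j hv => ?_,
      fun v hv => ?_⟩
    · rw [Finset.mem_preimage]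
      exact hFS (Finset.mem_image_of_mem _ hv)
    · rw [Finset.mem_preimage] at hv ⊢
      exact hS (k :: v) j hv
    · rw [Finset.mem_preimage] at hv
      refine le_trans ?_ (hb _ hv)
      have hsum : Summable fun u => if u ∈ S then 0 else treeEntry α t u (k :: v) ^ 2 :=
        (hc (k :: v)).of_nonneg_of_le (fun u => by split_ifs; exacts [le_rfl, sq_nonneg _])
          (fun u => by split_ifs; exacts [sq_nonneg _, le_rfl])
      simp only [treeEntry_subMarks, Finset.mem_preimage]
      refine tsum_comp_le_tsum_of_inj hsum (fun u => ?_) hinj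
      split_ifs
      exacts [le_rfl, sq_nonneg _]

/-- The restriction of a vector to the subtree below the child `k` of the root. -/
def subVector (ψ : TreeL2) (k : ℕ) : TreeL2 :=
  ⟨fun v => ψ (k :: v), by
    have := (memℓp_gen_iff (p := 2) (by simp)).1 (lp.memℓp ψ)
    exact (memℓp_gen_iff (p := 2) (by simp)).2 (this.comp_injective List.cons_injective)⟩

/-- The only edge leaving the subtree below `k` joins `[k]` to the root; its contribution is
subtracted. -/
theorem inner_treeColumn_subVector (h : GoodMarks α t) (ψ : TreeL2) (k : ℕ) (v : TreeVertex) :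
    inner ℂ (treeColumn α (subMarks t k) v) (subVector ψ k) =
      inner ℂ (treeColumn α t (k :: v)) ψ -
        (if v = [] then (edgeWeight α (t [k]) : ℂ) else 0) * ψ [] := by
  have h1 := hasSum_ite_sub_hasSum (inner_treeColumn h.columns (k :: v) ψ) []
  have h2 := inner_treeColumn (h.subMarks k).columns v (subVector ψ k)
  have h3 := (Function.Injective.hasSum_iff (List.cons_injective (a := k)) ?_).2 h1
  · have hfun : ((fun u => if u = [] then 0 else (treeEntry α t (k :: v) u : ℂ) * ψ u) ∘
        List.cons k) = fun w => (treeEntry α (subMarks t k) v w : ℂ) * subVector ψ k w := by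
      funext w
      rw [Function.comp_apply, if_neg (by simp), treeEntry_subMarks]
      rfl
    rw [hfun] at h3
    rw [h2.unique h3, treeEntry_cons_nil]
    split_ifs <;> simp
  · intro u hu
    cases u with
    | nil => simp
    | cons j w =>
      have hjk : j ≠ k := fun hjk => hu ⟨w, by rw [hjk]⟩
      simp [treeEntry_cons_cons_of_ne hjk]

/-- Restricted to the subtree, the root vector solves the subtree's equation with source -wₖ h(z) at
the subtree root; uniqueness identifies it. -/
theorem GoodMarks.rootVector_child (h : GoodMarks α t) {z : ℂ} (hz : z.im ≠ 0) (k : ℕ) :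
    rootVector α t z [k] = -(edgeWeight α (t [k]) * rootResolvent α t z) *
      rootResolvent α (_root_.subMarks t k) z := by
  have key : subVector (rootVector α t z) k = (-(edgeWeight α (t [k]) * rootResolvent α t z) : ℂ) •
      rootVector α (_root_.subMarks t k) z := by
    refine (h.subMarks k).eq_smul_rootVector hz fun v => ?_
    have h1 := h.rootVector_spec hz (k :: v)
    rw [if_neg (by simp)] at h1
    have h2 : subVector (rootVector α t z) k v = rootVector α t z (k :: v) := rfl
    rw [inner_treeColumn_subVector h, h2, rootResolvent_eq]
    split_ifs <;> linear_combination h1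
  have : subVector (rootVector α t z) k [] = rootVector α t z [k] := rfl
  rw [← this, key, rootResolvent_eq (t := _root_.subMarks t k)]
  rfl

/-- The Schur complement formula at the root. -/
theorem GoodMarks.rootResolvent_recursion (h : GoodMarks α t) {z : ℂ} (hz : z.im ≠ 0) :
    rootResolvent α t z = -(z + ∑' k, ((edgeWeight α (t [k]) ^ 2 : ℝ) : ℂ) *
      rootResolvent α (_root_.subMarks t k) z)⁻¹ := by
  have h1 := h.rootVector_spec hz []
  rw [if_pos rfl, ← rootResolvent_eq] at h1
  have h2 := inner_treeColumn h.columns [] (rootVector α t z)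
  have hinj : Function.Injective (fun k : ℕ => ([k] : TreeVertex)) :=
    fun a b hab => by simpa using hab
  have h3 := (hinj.hasSum_iff ?_).2 h2
  · have h4 : HasSum (fun k => -(rootResolvent α t z) * (((edgeWeight α (t [k]) ^ 2 : ℝ) : ℂ) *
      rootResolvent α (_root_.subMarks t k) z)) (1 + z * rootResolvent α t z) := by
      rw [← h1, sub_add_cancel]
      convert h3 using 2 with k
      simp only [Function.comp_apply]
      rw [h.rootVector_child hz, ← List.nil_append [k], treeEntry_child]
      push_cast
      ring
    -- If h(z) = 0, all children coordinates vanish too, and the equation at the root reads 0 = 1.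
    have hne : rootResolvent α t z ≠ 0 := by
      intro h0
      rw [h0] at h4
      simp only [neg_zero, zero_mul, mul_zero, add_zero] at h4
      exact zero_ne_one (hasSum_zero.unique h4)
    have h5 := (h4.mul_left (-(rootResolvent α t z))⁻¹).tsum_eq
    simp only [← mul_assoc, inv_mul_cancel₀ (neg_ne_zero.2 hne), one_mul] at h5
    rw [h5]
    field_simp
    ring
  · intro u hu
    have : treeEntry α t [] u = 0 := by
      by_contra h0
      rcases exists_of_treeEntry_ne_zero h0 with ⟨j, hj⟩ | ⟨j, hj⟩
      · exact hu ⟨j, hj.symm⟩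
      · simp at hj
    simp [this]

/-! ### Truncation at finite depth -/

/-- The marks up to depth `n`; the deeper edges get the weight `0`. -/
def truncMarks (n : ℕ) (t : TreeVertex → ℝ) : TreeVertex → ℝ :=
  fun v => if v.length ≤ n then t v else 0

theorem edgeWeight_zero : edgeWeight α 0 = 0 := by simp [edgeWeight]

theorem treeEntry_truncMarks (n : ℕ) (v w : TreeVertex) :
    treeEntry α (truncMarks n t) v w =
      if v.length ≤ n ∧ w.length ≤ n then treeEntry α t v w else 0 := by
  by_cases h1 : ∃ k, w = v ++ [k]
  · obtain ⟨k, rfl⟩ := h1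
    rw [treeEntry_child, treeEntry_child]
    by_cases h : (v ++ [k]).length ≤ n
    · rw [truncMarks, if_pos h, if_pos ⟨by simp at h; omega, h⟩]
    · rw [truncMarks, if_neg h, if_neg (fun h' => h h'.2), edgeWeight_zero]
  by_cases h2 : ∃ k, v = w ++ [k]
  · obtain ⟨k, rfl⟩ := h2
    rw [treeEntry_child', treeEntry_child']
    by_cases h : (w ++ [k]).length ≤ n
    · rw [truncMarks, if_pos h, if_pos ⟨h, by simp at h; omega⟩]
    · rw [truncMarks, if_neg h, if_neg (fun h' => h h'.1), edgeWeight_zero]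
  · simp [treeEntry, h1, h2]

theorem GoodMarks.truncMarks (h : GoodMarks α t) (n : ℕ) : GoodMarks α (truncMarks n t) := by
  refine h.of_abs_le fun v w => ?_
  rw [treeEntry_truncMarks]
  split_ifs
  · exact le_rfl
  · simp

theorem treeColumn_truncMarks (h : GoodMarks α t) {n : ℕ} {w : TreeVertex} (hw : w.length < n) :
    treeColumn α (truncMarks n t) w = treeColumn α t w := by
  ext v
  rw [treeColumn_apply (h.truncMarks n).columns, treeColumn_apply h.columns, treeEntry_truncMarks]
  split_ifs with hv
  · rfl
  · have : treeEntry α t v w = 0 := by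
      by_contra h0
      rcases exists_of_treeEntry_ne_zero h0 with ⟨j, hj⟩ | ⟨j, hj⟩ <;>
      · have := congrArg List.length hj
        simp at this
        exact hv ⟨by omega, by omega⟩
    rw [this]

/-- Strong resolvent convergence on a common core: approximate the root vector in graph norm by a
finitely supported φ. For large n the truncated operator agrees with T on φ, and its resolvent is
bounded by 1/|Im z|. -/
theorem GoodMarks.tendsto_rootResolvent_truncMarks (h : GoodMarks α t) {z : ℂ} (hz : z.im ≠ 0) :
    Tendsto (fun n => rootResolvent α (_root_.truncMarks n t) z) atTop
      (𝓝 (rootResolvent α t z)) := by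
  have hzpos := abs_pos.2 hz
  obtain ⟨x, hx, hxy⟩ := (h.isResolventAt hz).2 (treeDelta [])
  have hcl := ((treeOperatorCore_isFormalAdjoint h.columns).isClosable
    dense_treeOperatorCore_domain).graph_closure_eq_closure_graph
  have hmem : ((x : TreeL2), treeOperator α t x) ∈
      closure ((treeOperatorCore α t).graph : Set (TreeL2 × TreeL2)) := by
    rw [← Submodule.topologicalClosure_coe, hcl]
    exact LinearPMap.mem_graph _ x
  rw [Metric.tendsto_atTop]
  intro ε hε
  -- The final error has two parts: η (1 + ‖z‖) / |Im z| through the truncated resolvent, and η from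
  -- φ itself.
  obtain ⟨p, hp, hdist⟩ := Metric.mem_closure_iff.1 hmem
    (ε / (1 + (1 + ‖z‖) / |z.im|)) (by positivity)
  obtain ⟨φ, hφ1, hφ2⟩ := (LinearPMap.mem_graph_iff _).1 hp
  set η := ε / (1 + (1 + ‖z‖) / |z.im|)
  have hη : η * (1 + (1 + ‖z‖) / |z.im|) = ε := div_mul_cancel₀ _ (by positivity)
  rw [Prod.dist_eq, max_lt_iff, ← hφ1, ← hφ2, dist_comm, dist_comm (treeOperator α t x),
    dist_eq_norm, dist_eq_norm] at hdist
  obtain ⟨hd1, hd2⟩ := hdist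
  have hfin : (Function.support (φ.1 : TreeVertex → ℂ)).Finite := φ.2
  -- A column also involves the children, one level deeper, whence the `+ 1`.
  refine ⟨hfin.toFinset.sup List.length + 1, fun n hn => ?_⟩
  have hgn := h.truncMarks n
  have hcore : treeOperatorCore α (_root_.truncMarks n t) ⟨φ, φ.2⟩ =
      treeOperatorCore α t φ := by
    rw [treeOperatorCore_apply, treeOperatorCore_apply]
    refine Finset.sum_congr rfl fun w hw => ?_
    have : w.length ≤ hfin.toFinset.sup List.length := Finset.le_sup (f := List.length) hw
    rw [treeColumn_truncMarks h (by omega)]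
  have hR := hgn.isResolventAt hz
  have hTc := LinearPMap.le_closure (treeOperatorCore α (_root_.truncMarks n t))
  have hφn : treeOperator α (_root_.truncMarks n t) ⟨φ, hTc.1 φ.2⟩ = treeOperatorCore α t φ := by
    rw [← hcore]
    exact (hTc.2 rfl).symm
  have h1 := hR.1 ⟨φ, hTc.1 φ.2⟩
  rw [hφn] at h1
  have h2 := hR.norm_le hgn.treeOperator_isFormalAdjoint
    (treeDelta [] - (treeOperatorCore α t φ - z • (φ : TreeL2)))
  rw [map_sub, h1] at h2
  have h3 : ‖treeDelta [] - (treeOperatorCore α t φ - z • (φ : TreeL2))‖ ≤ η + ‖z‖ * η := by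
    have : treeDelta [] - (treeOperatorCore α t φ - z • (φ : TreeL2)) =
        z • ((φ : TreeL2) - x) - (treeOperatorCore α t φ - treeOperator α t x) := by
      rw [← hxy, smul_sub]; abel
    rw [this]
    refine (norm_sub_le _ _).trans ?_
    rw [norm_smul, add_comm]
    gcongr
  have h4 : ‖rootVector α (_root_.truncMarks n t) z - φ‖ ≤ η * ((1 + ‖z‖) / |z.im|) := by
    rw [mul_div_assoc', le_div_iff₀ hzpos]
    calc _ = |z.im| * ‖rootVector α (_root_.truncMarks n t) z - φ‖ := mul_comm _ _
      _ ≤ _ := h2.trans h3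
      _ = _ := by ring
  have h5 : ‖rootVector α (_root_.truncMarks n t) z - rootVector α t z‖ < ε := by
    have hx' : rootVector α t z = x := hx.symm
    calc _ = ‖(rootVector α (_root_.truncMarks n t) z - φ) + (φ - x)‖ := by
          rw [hx', sub_add_sub_cancel]
      _ ≤ _ := norm_add_le _ _
      _ < η * ((1 + ‖z‖) / |z.im|) + η := add_lt_add_of_le_of_lt h4 hd1
      _ = ε := by rw [← hη]; ring
  rw [dist_eq_norm, rootResolvent_eq, rootResolvent_eq]
  exact (lp.norm_apply_le_norm (p := 2) (by simp)
    (rootVector α (_root_.truncMarks n t) z - rootVector α t z) []).trans_lt h5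

/-- The root resolvent of the tree truncated at depth `n`, computed recursively. -/
def depthResolvent (α : ℝ) (z : ℂ) : ℕ → (TreeVertex → ℝ) → ℂ
  | 0, _ => -z⁻¹
  | n + 1, t => -(z + ∑' k, ((edgeWeight α (t [k]) ^ 2 : ℝ) : ℂ) *
      depthResolvent α z n (subMarks t k))⁻¹

theorem GoodMarks.rootResolvent_truncMarks (h : GoodMarks α t) {z : ℂ} (hz : z.im ≠ 0) (n : ℕ) :
    rootResolvent α (_root_.truncMarks n t) z = depthResolvent α z n t := by
  induction n generalizing t with
  | zero =>
    rw [(h.truncMarks 0).rootResolvent_recursion hz, depthResolvent]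
    simp [_root_.truncMarks, edgeWeight_zero]
  | succ n ih =>
    rw [(h.truncMarks (n + 1)).rootResolvent_recursion hz, depthResolvent]
    congr 3
    refine tsum_congr fun k => ?_
    have : _root_.subMarks (_root_.truncMarks (n + 1) t) k =
        _root_.truncMarks n (_root_.subMarks t k) := by
      funext v
      simp [_root_.subMarks, _root_.truncMarks]
    rw [this, ih (h.subMarks k)]
    simp [_root_.truncMarks]

theorem GoodMarks.tendsto_depthResolvent (h : GoodMarks α t) {z : ℂ} (hz : z.im ≠ 0) :
    Tendsto (fun n => depthResolvent α z n t) atTop (𝓝 (rootResolvent α t z)) :=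
  (h.tendsto_rootResolvent_truncMarks hz).congr fun n => h.rootResolvent_truncMarks hz n

/-- Inductively, every denominator has imaginary part at least Im z. No condition on the marks is
needed. -/
theorem depthResolvent_bound {z : ℂ} (hz : 0 < z.im) (n : ℕ) (t : TreeVertex → ℝ) :
    0 ≤ (depthResolvent α z n t).im ∧ ‖depthResolvent α z n t‖ ≤ 1 / z.im := by
  have aux : ∀ w : ℂ, z.im ≤ w.im → 0 ≤ (-w⁻¹).im ∧ ‖-w⁻¹‖ ≤ 1 / z.im := by
    intro w hw
    have hw0 : 0 < w.im := hz.trans_le hw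
    constructor
    · rw [Complex.neg_im, Complex.inv_im, neg_div, neg_neg]
      exact div_nonneg hw0.le (Complex.normSq_nonneg _)
    · rw [norm_neg, norm_inv, ← one_div]
      exact one_div_le_one_div_of_le hz
        (hw.trans ((le_abs_self _).trans (Complex.abs_im_le_norm w)))
  induction n generalizing t with
  | zero => exact aux z le_rfl
  | succ n ih =>
    refine aux _ ?_
    rw [Complex.add_im, le_add_iff_nonneg_right]
    by_cases hs : Summable fun k => ((edgeWeight α (t [k]) ^ 2 : ℝ) : ℂ) *
      depthResolvent α z n (subMarks t k)
    · rw [Complex.im_tsum hs]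
      refine tsum_nonneg fun k => ?_
      rw [Complex.im_ofReal_mul]
      exact mul_nonneg (sq_nonneg _) (ih _).1
    -- A divergent sum has the default value 0, which leaves the denominator equal to z.
    · rw [tsum_eq_zero_of_not_summable hs]
      simp

end TreeRecursion

/-! ### Counting points of a Poisson process -/

section PoissonFacts

theorem poissonMeasure_singleton_succ_mul (r : ℝ≥0) (n : ℕ) :
    poissonMeasure r {n + 1} * ((n + 1 : ℕ) : ℝ≥0∞) = r * poissonMeasure r {n} := by
  rw [poissonMeasure_singleton, poissonMeasure_singleton, ← ENNReal.ofReal_natCast,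
    ← ENNReal.ofReal_mul (by positivity), ← ENNReal.ofReal_coe_nnreal,
    ← ENNReal.ofReal_mul (by positivity)]
  congr 1
  rw [Nat.factorial_succ]
  have : ((n.factorial : ℕ) : ℝ) ≠ 0 := by positivity
  push_cast
  field_simp
  ring

theorem tsum_poissonMeasure_singleton (r : ℝ≥0) : ∑' n, poissonMeasure r {n} = 1 := by
  have := lintegral_countable' (μ := poissonMeasure r) (fun _ => 1)
  simp only [one_mul, lintegral_one, measure_univ] at this
  exact this.symm

theorem lintegral_natCast_poissonMeasure (r : ℝ≥0) :
    ∫⁻ n, (n : ℝ≥0∞) ∂poissonMeasure r = r := by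
  rw [lintegral_countable', tsum_eq_zero_add' ENNReal.summable]
  have h : ∀ n, ((n + 1 : ℕ) : ℝ≥0∞) * poissonMeasure r {n + 1} = r * poissonMeasure r {n} :=
    fun n => by rw [mul_comm, poissonMeasure_singleton_succ_mul]
  simp only [h, ENNReal.tsum_mul_left, tsum_poissonMeasure_singleton, mul_one, Nat.cast_zero,
    zero_mul, zero_add]

/-- As i! n! ≤ (i + n)!, the mass at i + n is at most rⁿ/n! times the mass at i. -/
theorem poissonMeasure_Ici_le (r : ℝ≥0) (n : ℕ) :
    poissonMeasure r (Ici n) ≤ ENNReal.ofReal (r ^ n / n.factorial) := by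
  have hU : Ici n = ⋃ i : ℕ, {i + n} := by
    ext j
    simp only [mem_Ici, mem_iUnion, mem_singleton_iff]
    exact ⟨fun h => ⟨j - n, by omega⟩, fun ⟨i, hi⟩ => by omega⟩
  rw [hU]
  refine (measure_iUnion_le _).trans ?_
  calc ∑' i, poissonMeasure r {i + n}
      ≤ ∑' i, ENNReal.ofReal (r ^ n / n.factorial) * poissonMeasure r {i} := by
        refine ENNReal.tsum_le_tsum fun i => ?_
        rw [poissonMeasure_singleton, poissonMeasure_singleton,
          ← ENNReal.ofReal_mul (by positivity)]
        refine ENNReal.ofReal_le_ofReal ?_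
        have h1 : ((i.factorial * n.factorial : ℕ) : ℝ) ≤ ((i + n).factorial : ℕ) :=
          Nat.cast_le.2 (Nat.le_of_dvd (Nat.factorial_pos _)
            (Nat.factorial_mul_factorial_dvd_factorial_add i n))
        push_cast at h1
        rw [pow_add, div_mul_div_comm]
        calc _ ≤ Real.exp (-r) * (r ^ i * r ^ n) / (i.factorial * n.factorial) := by gcongr
          _ = _ := by ring_nf
    _ = _ := by rw [ENNReal.tsum_mul_left, tsum_poissonMeasure_singleton, mul_one]

theorem pointCount_eq_tsum {Ω E : Type*} (ξ : ℕ → Ω → E) (B : Set E) (ω : Ω) :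
    (pointCount ξ B ω : ℝ≥0∞) = ∑' k, (ξ k ⁻¹' B).indicator 1 ω := by
  rw [pointCount, ← ENNReal.tsum_set_one, tsum_subtype _ (fun _ => (1 : ℝ≥0∞))]
  refine tsum_congr fun k => ?_
  by_cases h : ξ k ω ∈ B <;> simp [Set.indicator, h]

variable {Ω E : Type*} [MeasurableSpace Ω] [MeasurableSpace E] {P : Measure Ω}
  {ξ : ℕ → Ω → E} {ν : Measure E}

namespace IsPoissonPointProcess

theorem ae_pointCount_ne_top (hξ : IsPoissonPointProcess P ξ ν) {B : Set E}
    (hB : MeasurableSet B) (hν : ν B ≠ ∞) : ∀ᵐ ω ∂P, pointCount ξ B ω ≠ ⊤ := by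
  have h := (hξ.hasLaw_count B hB hν).measure_eq (p := fun n => n = ⊤) (.of_discrete)
  rw [ae_iff]
  simp only [not_not]
  rw [h, Measure.map_apply .of_discrete .of_discrete]
  convert measure_empty (μ := poissonMeasure (ν B).toNNReal)
  ext n
  simp

theorem ae_finite (hξ : IsPoissonPointProcess P ξ ν) {B : Set E}
    (hB : MeasurableSet B) (hν : ν B ≠ ∞) : ∀ᵐ ω ∂P, {k | ξ k ω ∈ B}.Finite := by
  filter_upwards [hξ.ae_pointCount_ne_top hB hν] with ω h
  exact Set.encard_ne_top_iff.1 h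

theorem tsum_measure_preimage (hξ : IsPoissonPointProcess P ξ ν) {B : Set E}
    (hB : MeasurableSet B) (hν : ν B ≠ ∞) : ∑' k, P (ξ k ⁻¹' B) = ν B := by
  have hlaw := hξ.hasLaw_count B hB hν
  calc ∑' k, P (ξ k ⁻¹' B) = ∑' k, ∫⁻ ω, (ξ k ⁻¹' B).indicator 1 ω ∂P := by
        refine tsum_congr fun k => ?_
        rw [lintegral_indicator_one (hξ.measurable k hB)]
    _ = ∫⁻ ω, (pointCount ξ B ω : ℝ≥0∞) ∂P := by
        rw [← lintegral_tsum fun k =>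
          (measurable_one.indicator (hξ.measurable k hB)).aemeasurable]
        simp_rw [pointCount_eq_tsum]
    _ = ∫⁻ n, (n : ℝ≥0∞) ∂((poissonMeasure (ν B).toNNReal).map (Nat.cast : ℕ → ℕ∞)) := by
        rw [← hlaw.map_eq, lintegral_map' .of_discrete hlaw.aemeasurable]
    _ = ν B := by
        rw [lintegral_map .of_discrete .of_discrete]
        simp only [ENat.toENNReal_coe]
        rw [lintegral_natCast_poissonMeasure, ENNReal.coe_toNNReal hν]

theorem ae_forall_notMem (hξ : IsPoissonPointProcess P ξ ν) {B : Set E}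
    (hB : MeasurableSet B) (hν : ν B = 0) : ∀ᵐ ω ∂P, ∀ k, ξ k ω ∉ B := by
  have h := hξ.tsum_measure_preimage hB (by simp [hν])
  rw [hν, ENNReal.tsum_eq_zero] at h
  rw [ae_all_iff]
  intro k
  exact measure_eq_zero_iff_ae_notMem.1 (h k)

/-- Campbell's formula: the mean measure of the points agrees with ν on sets of finite intensity,
and σ-finiteness extends this to all sets. -/
theorem lintegral_tsum_eq (hξ : IsPoissonPointProcess P ξ ν) [SigmaFinite ν] {f : E → ℝ≥0∞}
    (hf : Measurable f) : ∫⁻ ω, ∑' k, f (ξ k ω) ∂P = ∫⁻ x, f x ∂ν := by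
  have hsum : Measure.sum (fun k => P.map (ξ k)) = ν := by
    have hfin : ∀ s, MeasurableSet s → ν s ≠ ∞ → Measure.sum (fun k => P.map (ξ k)) s = ν s := by
      intro s hs hs'
      rw [Measure.sum_apply _ hs, ← hξ.tsum_measure_preimage hs hs']
      refine tsum_congr fun k => ?_
      rw [Measure.map_apply (hξ.measurable k) hs]
    ext s hs
    have hU : s = ⋃ n, s ∩ spanningSets ν n := by
      rw [← inter_iUnion, iUnion_spanningSets, inter_univ]
    have hmono : Monotone fun n => s ∩ spanningSets ν n := fun a b hab =>
      inter_subset_inter_right _ (monotone_spanningSets ν hab)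
    rw [hU, hmono.measure_iUnion, hmono.measure_iUnion]
    exact iSup_congr fun n => hfin _ (hs.inter (measurableSet_spanningSets ν n))
      (measure_ne_top_of_subset inter_subset_right (measure_spanningSets_lt_top ν n).ne)
  rw [lintegral_tsum (f := fun k ω => f (ξ k ω)) fun k => (hf.comp (hξ.measurable k)).aemeasurable]
  conv_rhs => rw [← hsum, lintegral_sum_measure]
  refine tsum_congr fun k => ?_
  rw [lintegral_map hf (hξ.measurable k)]

/-- The image of a Poisson point process. -/
theorem map {E' : Type*} [MeasurableSpace E'] (hξ : IsPoissonPointProcess P ξ ν) {f : E → E'}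
    (hf : Measurable f) : IsPoissonPointProcess P (fun k ω => f (ξ k ω)) (ν.map f) where
  measurable k := hf.comp (hξ.measurable k)
  hasLaw_count B hB hν := by
    rw [Measure.map_apply hf hB] at hν ⊢
    exact hξ.hasLaw_count _ (hf hB) hν
  indep_count m B hB hd :=
    hξ.indep_count m (fun i => f ⁻¹' B i) (fun i => hf (hB i)) fun i j hij =>
      (hd hij).preimage f

end IsPoissonPointProcess

end PoissonFacts

/-! ### Sums over a Poisson process with independent marks -/

section MarkedPoisson

/-- The points `ξ k` form a Poisson point process of intensity `ν`, and the marks `h k` are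
independent of law `μ`, and independent of the points. -/
structure IsMarkedPoisson {Ω : Type*} [MeasurableSpace Ω] (P : Measure Ω) (ξ : ℕ → Ω → ℝ)
    (h : ℕ → Ω → ℂ) (ν : Measure ℝ) (μ : Measure ℂ) : Prop where
  poisson : IsPoissonPointProcess P ξ ν
  hasLaw : ∀ k, HasLaw (h k) μ P
  indep : iIndepFun h P
  indep_points : IndepFun (fun ω k => h k ω) (fun ω k => ξ k ω) P

variable {Ω : Type*} [MeasurableSpace Ω] {P : Measure Ω} {ξ : ℕ → Ω → ℝ} {h : ℕ → Ω → ℂ}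
  {ν : Measure ℝ} {μ : Measure ℂ}

namespace IsMarkedPoisson

/-- Fubini: with the points frozen, the summands are independent multiples of the marks. -/
theorem integral_exp_partial_sum [IsProbabilityMeasure P] (H : IsMarkedPoisson P ξ h ν μ)
    {g : ℝ → ℝ} (hg : Measurable g) (s : ℂ) (M : ℕ) :
    ∫ ω, Complex.exp (inner ℝ (∑ k ∈ Finset.range M, g (ξ k ω) • h k ω) s * Complex.I) ∂P =
      ∫ ω, ∏ k ∈ Finset.range M, charFun μ (g (ξ k ω) • s) ∂P := by
  have : IsProbabilityMeasure μ := by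
    rw [← (H.hasLaw 0).map_eq]
    exact Measure.isProbabilityMeasure_map (H.hasLaw 0).aemeasurable
  have hH : AEMeasurable (fun ω k => h k ω) P :=
    aemeasurable_pi_lambda _ fun k => (H.hasLaw k).aemeasurable
  have hΞ : Measurable (fun ω k => ξ k ω) := measurable_pi_lambda _ H.poisson.measurable
  have hprod := (indepFun_iff_map_prod_eq_prod_map_map hΞ.aemeasurable hH).1 H.indep_points.symm
  let F : (ℕ → ℝ) × (ℕ → ℂ) → ℂ := fun p =>
    Complex.exp (inner ℝ (∑ k ∈ Finset.range M, g (p.1 k) • p.2 k) s * Complex.I)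
  have hsumm : Measurable fun p : (ℕ → ℝ) × (ℕ → ℂ) =>
      ∑ k ∈ Finset.range M, g (p.1 k) • p.2 k := by
    refine Finset.measurable_sum _ fun k _ => ?_
    exact (hg.comp (measurable_fst.eval)).smul (measurable_snd.eval)
  have hF : Measurable F := by
    have : Measurable fun p : (ℕ → ℝ) × (ℕ → ℂ) =>
      inner ℝ (∑ k ∈ Finset.range M, g (p.1 k) • p.2 k) s := hsumm.inner measurable_const
    exact Complex.measurable_exp.comp ((Complex.measurable_ofReal.comp this).mul_const _)
  have hFn : ∀ p, ‖F p‖ = 1 := fun p => Complex.norm_exp_ofReal_mul_I _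
  have hinner : ∀ x : ℕ → ℝ, ∫ a, F (x, a) ∂(P.map fun ω k => h k ω) =
      ∏ k ∈ Finset.range M, charFun μ (g (x k) • s) := by
    intro x
    rw [integral_map (f := fun a => F (x, a)) hH
      (hF.comp measurable_prodMk_left).aestronglyMeasurable]
    have hind : iIndepFun (fun k ω => g (x k) • h k ω) P :=
      H.indep.comp (fun k w => g (x k) • w) fun k => measurable_const_smul _
    have hch := iIndepFun.charFun_map_fun_finsetSum_eq_prod (s := Finset.range M)
      (X := fun k ω => g (x k) • h k ω)
      (fun k _ => (H.hasLaw k).aemeasurable.fun_const_smul _) (hind.restrict _)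
    have hch' := congrFun hch s
    rw [charFun_apply, integral_map, Finset.prod_apply] at hch'
    · rw [hch']
      refine Finset.prod_congr rfl fun k _ => ?_
      rw [charFun_map_smul_comp (H.hasLaw k).aemeasurable, (H.hasLaw k).map_eq]
    · exact Finset.aemeasurable_fun_sum _ fun k _ => (H.hasLaw k).aemeasurable.fun_const_smul _
    · exact (Complex.measurable_exp.comp ((Complex.measurable_ofReal.comp
        (measurable_id.inner measurable_const)).mul_const _)).aestronglyMeasurable
  calc _ = ∫ ω, F (fun k => ξ k ω, fun k => h k ω) ∂P := rfl
    _ = ∫ p, F p ∂(P.map fun ω => (fun k => ξ k ω, fun k => h k ω)) :=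
        (integral_map (hΞ.aemeasurable.prodMk hH) hF.aestronglyMeasurable).symm
    _ = ∫ x, ∫ a, F (x, a) ∂(P.map fun ω k => h k ω) ∂(P.map fun ω k => ξ k ω) := by
        have : IsProbabilityMeasure (P.map fun ω k => h k ω) := Measure.isProbabilityMeasure_map hH
        have : IsProbabilityMeasure (P.map fun ω k => ξ k ω) :=
          Measure.isProbabilityMeasure_map hΞ.aemeasurable
        rw [hprod, integral_prod]
        exact Integrable.of_bound hF.aestronglyMeasurable 1 (ae_of_all _ fun p => (hFn p).le)
    _ = ∫ x, ∏ k ∈ Finset.range M, charFun μ (g (x k) • s) ∂(P.map fun ω k => ξ k ω) := by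
        simp_rw [hinner]
    _ = _ := by
        rw [integral_map hΞ.aemeasurable]
        refine (Finset.measurable_prod _ fun k _ => ?_).aestronglyMeasurable
        exact measurable_charFun.comp ((hg.comp (measurable_pi_apply k)).smul_const s)

theorem aemeasurable_tsum (H : IsMarkedPoisson P ξ h ν μ) {g : ℝ → ℝ} (hg : Measurable g)
    (hs : ∀ᵐ ω ∂P, Summable fun k => g (ξ k ω) • h k ω) :
    AEMeasurable (fun ω => ∑' k, g (ξ k ω) • h k ω) P := by
  refine aemeasurable_of_tendsto_metrizable_ae atTop
    (f := fun M ω => ∑ k ∈ Finset.range M, g (ξ k ω) • h k ω) (fun M => ?_) ?_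
  · exact Finset.aemeasurable_fun_sum _ fun k _ =>
      (hg.comp (H.poisson.measurable k)).aemeasurable.smul (H.hasLaw k).aemeasurable
  · filter_upwards [hs] with ω hω
    exact hω.hasSum.tendsto_sum_nat

theorem tendsto_integral_exp [IsProbabilityMeasure P] {X : ℕ → Ω → ℂ} {Y : Ω → ℂ}
    (hX : ∀ n, AEMeasurable (X n) P) (hXY : ∀ᵐ ω ∂P, Tendsto (fun n => X n ω) atTop (𝓝 (Y ω)))
    (s : ℂ) : Tendsto (fun n => ∫ ω, Complex.exp (inner ℝ (X n ω) s * Complex.I) ∂P) atTop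
      (𝓝 (∫ ω, Complex.exp (inner ℝ (Y ω) s * Complex.I) ∂P)) := by
  refine tendsto_integral_of_dominated_convergence (fun _ => 1) (fun n => ?_)
    (integrable_const 1) (fun n => ?_) ?_
  · exact (Complex.measurable_exp.comp_aemeasurable ((Complex.measurable_ofReal.comp_aemeasurable
      ((hX n).inner aemeasurable_const)).mul_const _)).aestronglyMeasurable
  · exact ae_of_all _ fun ω => (Complex.norm_exp_ofReal_mul_I _).le
  · filter_upwards [hXY] with ω hω
    have hc : Continuous fun x : ℂ => Complex.exp (inner ℝ x s * Complex.I) := by fun_prop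
    exact (hc.tendsto _).comp hω

/-- The law of a sum over finitely many disjoint sets is determined by the intensity and the law
of the marks. -/
theorem integral_exp_simple [IsProbabilityMeasure P] (H : IsMarkedPoisson P ξ h ν μ)
    {m : ℕ} {B : Fin m → Set ℝ} (hB : ∀ i, MeasurableSet (B i))
    (hd : Pairwise fun i j => Disjoint (B i) (B j)) (hν : ∀ i, ν (B i) ≠ ∞) (c : Fin m → ℝ)
    {g : ℝ → ℝ} (hgm : Measurable g) (hgB : ∀ i, ∀ x ∈ B i, g x = c i)
    (hg0 : ∀ x, (∀ i, x ∉ B i) → g x = 0) (s : ℂ)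
    (hs : ∀ᵐ ω ∂P, Summable fun k => g (ξ k ω) • h k ω) :
    ∫ ω, Complex.exp (inner ℝ (∑' k, g (ξ k ω) • h k ω) s * Complex.I) ∂P =
      ∫ n : Fin m → ℕ∞, ∏ i, charFun μ (c i • s) ^ (n i).toNat
        ∂(Measure.pi fun i => (poissonMeasure (ν (B i)).toNNReal).map (Nat.cast : ℕ → ℕ∞)) := by
  have : IsProbabilityMeasure μ := by
    rw [← (H.hasLaw 0).map_eq]
    exact Measure.isProbabilityMeasure_map (H.hasLaw 0).aemeasurable
  have hlim := tendsto_integral_exp (X := fun M ω => ∑ k ∈ Finset.range M, g (ξ k ω) • h k ω)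
    (Y := fun ω => ∑' k, g (ξ k ω) • h k ω) (P := P)
    (fun M => Finset.aemeasurable_fun_sum _ fun k _ =>
      (hgm.comp (H.poisson.measurable k)).aemeasurable.smul (H.hasLaw k).aemeasurable)
    (by filter_upwards [hs] with ω hω using hω.hasSum.tendsto_sum_nat) s
  simp only [H.integral_exp_partial_sum hgm] at hlim
  have hlaw := fun i => H.poisson.hasLaw_count (B i) (hB i) (hν i)
  have hmap := (H.poisson.indep_count m B hB hd).map_fun_eq_pi_map fun i => (hlaw i).aemeasurable
  simp only [fun i => (hlaw i).map_eq] at hmap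
  rw [← hmap, integral_map (aemeasurable_pi_lambda _ fun i => (hlaw i).aemeasurable)]
  swap
  · exact (Measurable.of_discrete (f := fun n : Fin m → ℕ∞ =>
      ∏ i, charFun μ (c i • s) ^ (n i).toNat)).aestronglyMeasurable
  refine tendsto_nhds_unique hlim ?_
  refine tendsto_integral_of_dominated_convergence (fun _ => 1) (fun M => ?_)
    (integrable_const 1) (fun M => ?_) ?_
  · refine (Finset.measurable_prod _ fun k _ => ?_).aestronglyMeasurable
    exact measurable_charFun.comp ((hgm.comp (H.poisson.measurable k)).smul_const s)
  · refine ae_of_all _ fun ω => ?_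
    rw [norm_prod]
    exact Finset.prod_le_one (fun _ _ => norm_nonneg _) fun _ _ => norm_charFun_le_one _
  · have hfin : ∀ᵐ ω ∂P, ∀ i, {k | ξ k ω ∈ B i}.Finite :=
      ae_all_iff.2 fun i => H.poisson.ae_finite (hB i) (hν i)
    filter_upwards [hfin] with ω hω
    refine tendsto_const_nhds.congr' ?_
    -- Only finitely many points meet the cells, so the product over `k < M` is eventually constant
    -- in `M`.
    have hUfin : (⋃ i, {k | ξ k ω ∈ B i}).Finite := Set.finite_iUnion hω
    obtain ⟨N, hN⟩ := hUfin.bddAbove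
    filter_upwards [eventually_gt_atTop N] with M hM
    classical
    -- At most one factor differs from 1, the cells being disjoint; regrouping by cells leaves
    -- powers given by the counts.
    have hpt : ∀ x, charFun μ (g x • s) = ∏ i, if x ∈ B i then charFun μ (c i • s) else 1 := by
      intro x
      by_cases hx : ∃ i, x ∈ B i
      · obtain ⟨i, hi⟩ := hx
        rw [Finset.prod_eq_single i, if_pos hi, hgB i x hi]
        · intro j _ hj
          rw [if_neg fun hxj => Set.disjoint_left.1 (hd hj) hxj hi]
        · simp
      · push Not at hx
        rw [hg0 x hx, zero_smul, charFun_zero, Finset.prod_eq_one fun i _ => if_neg (hx i)]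
        simp
    simp only [hpt]
    rw [Finset.prod_comm]
    refine Finset.prod_congr rfl fun i _ => ?_
    rw [Finset.prod_ite, Finset.prod_const_one, mul_one, Finset.prod_const]
    congr 1
    rw [pointCount, ← Set.ncard_def, ← Set.ncard_coe_finset]
    congr 1
    ext k
    simp only [Finset.coe_filter, Finset.mem_range, mem_ofPred_eq]
    refine ⟨fun hk => ⟨?_, hk⟩, fun hk => hk.2⟩
    exact (hN (mem_iUnion.2 ⟨i, hk⟩)).trans_lt hM

end IsMarkedPoisson
end MarkedPoisson

/-! ### The law of a marked Poisson sum -/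

section MarkedPoissonLaw

/-- A measure on the positive half-line that is finite away from `0` and integrates `x` at `0`. -/
structure IsSummableIntensity (ν : Measure ℝ) : Prop where
  sigmaFinite : SigmaFinite ν
  nonpos : ν (Iic 0) = 0
  tail : ∀ a > 0, ν (Ici a) ≠ ∞
  small : ∫⁻ x in Iic 1, ENNReal.ofReal x ∂ν ≠ ∞

/-- The approximation of the identity of `(0, ∞)` by multiples of `1 / n` up to `n`. -/
def gridApprox (n : ℕ) (x : ℝ) : ℝ := if ⌊n * x⌋₊ ≤ n ^ 2 then (⌊n * x⌋₊ : ℝ) / n else 0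

theorem measurable_gridApprox (n : ℕ) : Measurable (gridApprox n) := by
  have h1 : Measurable fun x : ℝ => ⌊(n : ℝ) * x⌋₊ :=
    Nat.measurable_floor.comp (measurable_id.const_mul _)
  exact Measurable.ite (h1 (measurableSet_Iic (a := n ^ 2)))
    ((measurable_from_nat (f := fun j : ℕ => (j : ℝ))).comp h1 |>.div_const _) measurable_const

theorem gridApprox_nonneg (n : ℕ) (x : ℝ) : 0 ≤ gridApprox n x := by
  unfold gridApprox
  split_ifs <;> positivity

theorem gridApprox_le {x : ℝ} (hx : 0 ≤ x) (n : ℕ) : gridApprox n x ≤ x := by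
  unfold gridApprox
  split_ifs
  · rcases Nat.eq_zero_or_pos n with rfl | hn
    · simpa
    · rw [div_le_iff₀ (by positivity), mul_comm x]
      exact Nat.floor_le (by positivity)
  · exact hx

theorem tendsto_gridApprox {x : ℝ} (hx : 0 ≤ x) :
    Tendsto (fun n => gridApprox n x) atTop (𝓝 x) := by
  have h1 : Tendsto (fun n : ℕ => (⌊x * n⌋₊ : ℝ) / n) atTop (𝓝 x) :=
    (tendsto_nat_floor_mul_div_atTop hx).comp tendsto_natCast_atTop_atTop
  refine h1.congr' ?_
  filter_upwards [eventually_ge_atTop ⌈x⌉₊] with n hn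
  have hxn : x ≤ n := (Nat.le_ceil x).trans (Nat.cast_le.2 hn)
  have : ⌊(n : ℝ) * x⌋₊ ≤ n ^ 2 := by
    apply Nat.floor_le_of_le
    push_cast
    nlinarith [Nat.cast_nonneg (α := ℝ) n]
  rw [gridApprox, if_pos this, mul_comm]

variable {Ω : Type*} [MeasurableSpace Ω] {P : Measure Ω} {ξ : ℕ → Ω → ℝ} {h : ℕ → Ω → ℂ}
  {ν : Measure ℝ} {μ : Measure ℂ}

theorem IsPoissonPointProcess.ae_pos (hξ : IsPoissonPointProcess P ξ ν)
    (hν : IsSummableIntensity ν) : ∀ᵐ ω ∂P, ∀ k, 0 < ξ k ω := by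
  filter_upwards [hξ.ae_forall_notMem measurableSet_Iic hν.nonpos] with ω hω k
  simpa using hω k

/-- Campbell's formula handles the points up to 1; only finitely many exceed 1. -/
theorem IsPoissonPointProcess.ae_summable (hξ : IsPoissonPointProcess P ξ ν)
    (hν : IsSummableIntensity ν) : ∀ᵐ ω ∂P, Summable fun k => ξ k ω := by
  have := hν.sigmaFinite
  have hf : Measurable ((Iic (1 : ℝ)).indicator ENNReal.ofReal) :=
    ENNReal.measurable_ofReal.indicator measurableSet_Iic
  have h1 := hξ.lintegral_tsum_eq hf
  rw [lintegral_indicator measurableSet_Iic] at h1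
  have h2 : ∀ᵐ ω ∂P, ∑' k, (Iic (1 : ℝ)).indicator ENNReal.ofReal (ξ k ω) < ∞ :=
    ae_lt_top (Measurable.tsum fun k => hf.comp (hξ.measurable k)) (h1 ▸ hν.small)
  filter_upwards [h2, hξ.ae_finite measurableSet_Ici (hν.tail 1 one_pos), hξ.ae_pos hν]
    with ω h2 h3 hpos
  have h4 : Summable fun k => ((Iic (1 : ℝ)).indicator ENNReal.ofReal (ξ k ω)).toReal :=
    ENNReal.summable_toReal h2.ne
  refine (summable_congr_cofinite ?_).1 h4
  rw [EventuallyEq, eventually_cofinite]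
  refine h3.subset fun k hk => ?_
  by_contra hlt
  simp only [mem_ofPred_eq, mem_Ici, not_le] at hlt
  apply hk
  rw [indicator_of_mem (mem_Iic.2 hlt.le), ENNReal.toReal_ofReal (hpos k).le]

namespace IsMarkedPoisson

theorem ae_norm_le (H : IsMarkedPoisson P ξ h ν μ) {C : ℝ} (hC : ∀ᵐ w ∂μ, ‖w‖ ≤ C) :
    ∀ᵐ ω ∂P, ∀ k, ‖h k ω‖ ≤ C := by
  refine ae_all_iff.2 fun k => ?_
  rw [← (H.hasLaw k).map_eq] at hC
  exact ae_of_ae_map (H.hasLaw k).aemeasurable hC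

theorem ae_summable (H : IsMarkedPoisson P ξ h ν μ) (hν : IsSummableIntensity ν) {C : ℝ}
    (hC : ∀ᵐ w ∂μ, ‖w‖ ≤ C) {g : ℝ → ℝ} (hg : ∀ x, 0 ≤ x → |g x| ≤ x) :
    ∀ᵐ ω ∂P, Summable fun k => g (ξ k ω) • h k ω := by
  filter_upwards [H.poisson.ae_pos hν, H.poisson.ae_summable hν, H.ae_norm_le hC]
    with ω hpos hsum hb
  refine Summable.of_norm_bounded (hsum.mul_right C) fun k => ?_
  rw [norm_smul, Real.norm_eq_abs]
  exact mul_le_mul (hg _ (hpos k).le) (hb k) (norm_nonneg _) (hpos k).le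

/-- The cells on which `gridApprox` is a nonzero constant. -/
def gridCell (n : ℕ) (i : Fin (n ^ 2)) : Set ℝ := {x | ⌊(n : ℝ) * x⌋₊ = i + 1}

/-- The cutoff at `n ^ 2` leaves finitely many cells, and rounding down places them in [1/n, ∞),
where the intensity is finite. The right-hand side involves only ν and μ. -/
theorem integral_exp_gridApprox [IsProbabilityMeasure P] (H : IsMarkedPoisson P ξ h ν μ)
    (hν : IsSummableIntensity ν) {C : ℝ} (hC : ∀ᵐ w ∂μ, ‖w‖ ≤ C) (n : ℕ) (s : ℂ) :
    ∫ ω, Complex.exp (inner ℝ (∑' k, gridApprox n (ξ k ω) • h k ω) s * Complex.I) ∂P =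
      ∫ N : Fin (n ^ 2) → ℕ∞, ∏ i : Fin (n ^ 2),
        charFun μ ((((i : ℕ) + 1 : ℝ) / n) • s) ^ (N i).toNat
        ∂(Measure.pi fun i =>
          (poissonMeasure (ν (gridCell n i)).toNNReal).map (Nat.cast : ℕ → ℕ∞)) := by
  refine H.integral_exp_simple (B := gridCell n) (fun i => ?_) (fun i j hij => ?_) (fun i => ?_) _
    (measurable_gridApprox n) (fun i x hx => ?_) (fun x hx => ?_) s
    (H.ae_summable hν hC fun x hx => ?_)
  · exact (Nat.measurable_floor.comp (measurable_id.const_mul _)) (measurableSet_singleton _)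
  · refine Set.disjoint_left.2 fun x hx hx' => hij (Fin.ext ?_)
    have h1 : ⌊(n : ℝ) * x⌋₊ = i + 1 := hx
    have h2 : ⌊(n : ℝ) * x⌋₊ = j + 1 := hx'
    omega
  · have hn : 0 < n := by
      rcases Nat.eq_zero_or_pos n with rfl | hn
      · exact i.elim0
      · exact hn
    refine measure_ne_top_of_subset (fun x hx => ?_) (hν.tail (1 / n) (by positivity))
    have h1 : ⌊(n : ℝ) * x⌋₊ = i + 1 := hx
    have h2 : 1 ≤ (n : ℝ) * x := (Nat.one_le_floor_iff _).1 (by omega)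
    rw [mem_Ici, div_le_iff₀ (by positivity)]
    linarith
  · have h1 : ⌊(n : ℝ) * x⌋₊ = i + 1 := hx
    have := i.2
    rw [gridApprox, h1, if_pos (by omega)]
    push_cast
    rfl
  · rw [gridApprox]
    split_ifs with h1
    · rcases Nat.eq_zero_or_pos ⌊(n : ℝ) * x⌋₊ with h0 | h0
      · simp [h0]
      · refine absurd ?_ (hx ⟨⌊(n : ℝ) * x⌋₊ - 1, by omega⟩)
        change ⌊(n : ℝ) * x⌋₊ = ⌊(n : ℝ) * x⌋₊ - 1 + 1
        omega
    · rfl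
  · rw [abs_of_nonneg (gridApprox_nonneg n x)]
    exact gridApprox_le hx n

theorem tendsto_integral_exp_gridApprox [IsProbabilityMeasure P] (H : IsMarkedPoisson P ξ h ν μ)
    (hν : IsSummableIntensity ν) {C : ℝ} (hC : ∀ᵐ w ∂μ, ‖w‖ ≤ C) (s : ℂ) :
    Tendsto (fun n => ∫ ω, Complex.exp
      (inner ℝ (∑' k, gridApprox n (ξ k ω) • h k ω) s * Complex.I) ∂P) atTop
      (𝓝 (∫ ω, Complex.exp (inner ℝ (∑' k, ξ k ω • h k ω) s * Complex.I) ∂P)) := by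
  have hle : ∀ n x, 0 ≤ x → |gridApprox n x| ≤ x := fun n x hx => by
    rw [abs_of_nonneg (gridApprox_nonneg n x)]
    exact gridApprox_le hx n
  refine tendsto_integral_exp (fun n => H.aemeasurable_tsum (measurable_gridApprox n)
    (H.ae_summable hν hC (hle n))) ?_ s
  filter_upwards [H.poisson.ae_pos hν, H.poisson.ae_summable hν, H.ae_norm_le hC]
    with ω hpos hsum hb
  refine tendsto_tsum_of_dominated_convergence (hsum.mul_right C) (fun k => ?_)
    (Eventually.of_forall fun n k => ?_)
  · exact (tendsto_gridApprox (hpos k).le).smul_const _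
  · rw [norm_smul, Real.norm_eq_abs]
    exact mul_le_mul (hle n _ (hpos k).le) (hb k) (norm_nonneg _) (hpos k).le

/-- The law of the sum is determined by the intensity of the points and the law of the marks. -/
theorem identDistrib_tsum {Ω' : Type*} [MeasurableSpace Ω'] {P' : Measure Ω'} {ξ' : ℕ → Ω' → ℝ}
    {h' : ℕ → Ω' → ℂ} [IsProbabilityMeasure P] [IsProbabilityMeasure P']
    (H : IsMarkedPoisson P ξ h ν μ) (H' : IsMarkedPoisson P' ξ' h' ν μ)
    (hν : IsSummableIntensity ν) {C : ℝ} (hC : ∀ᵐ w ∂μ, ‖w‖ ≤ C) :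
    IdentDistrib (fun ω => ∑' k, ξ k ω • h k ω) (fun ω => ∑' k, ξ' k ω • h' k ω) P P' := by
  have hm := H.aemeasurable_tsum measurable_id
    (H.ae_summable hν hC fun x hx => (abs_of_nonneg hx).le)
  have hm' := H'.aemeasurable_tsum measurable_id
    (H'.ae_summable hν hC fun x hx => (abs_of_nonneg hx).le)
  refine ⟨hm, hm', ?_⟩
  have := Measure.isProbabilityMeasure_map hm
  have := Measure.isProbabilityMeasure_map hm'
  simp only [id_eq] at *
  refine Measure.ext_of_charFun (funext fun s => ?_)
  have hexp : ∀ ρ : Measure ℂ, AEStronglyMeasurable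
      (fun x : ℂ => Complex.exp (inner ℝ x s * Complex.I)) ρ := fun ρ =>
    Continuous.aestronglyMeasurable (by fun_prop)
  rw [charFun_apply, charFun_apply, integral_map hm (hexp _), integral_map hm' (hexp _)]
  -- Both discretised transforms are the same expression in ν and μ, so their limits coincide.
  have h1 := H.tendsto_integral_exp_gridApprox hν hC s
  have h2 := H'.tendsto_integral_exp_gridApprox hν hC s
  simp only [H.integral_exp_gridApprox hν hC, H'.integral_exp_gridApprox hν hC] at h1 h2
  exact tendsto_nhds_unique h1 h2

end IsMarkedPoisson
end MarkedPoissonLaw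

/-! ### Marks with finite clusters of early edges are good -/

section FiniteClusters

variable {α : ℝ} {t : TreeVertex → ℝ}

/-- Some mark below `v` at or after position `k` is small compared to its position. -/
def HasSmallMark (t : TreeVertex → ℝ) (v : TreeVertex) (k : ℕ) : Prop :=
  ∃ j ≥ k, |t (v ++ [j])| < (j + 1) / 12

/-- The word `v ++ u` is reached from `v` through edges followed by a small mark. -/
def IsClusterWord (t : TreeVertex → ℝ) (v u : TreeVertex) : Prop :=
  ∀ i (hi : i < u.length), HasSmallMark t (v ++ u.take i) u[i]

/-- All clusters of edges followed by small marks are finite. -/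
def HasFiniteClusters (t : TreeVertex → ℝ) : Prop :=
  ∀ v, {u | IsClusterWord t v u}.Finite

theorem IsClusterWord.of_append {v u : TreeVertex} {k : ℕ} (h : IsClusterWord t v (u ++ [k])) :
    IsClusterWord t v u := by
  intro i hi
  have := h i (by simp; omega)
  rwa [List.take_append_of_le_length hi.le, List.getElem_append_left hi] at this

theorem IsClusterWord.append {v u : TreeVertex} {k : ℕ} (h : IsClusterWord t v u)
    (hk : HasSmallMark t (v ++ u) k) : IsClusterWord t v (u ++ [k]) := by
  intro i hi
  rcases Nat.lt_or_ge i u.length with h1 | h1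
  · rw [List.take_append_of_le_length h1.le, List.getElem_append_left h1]
    exact h i h1
  · have : i = u.length := by simp at hi; omega
    subst this
    simpa using hk

theorem isClusterWord_nil (v : TreeVertex) : IsClusterWord t v [] := fun i hi => by simp at hi

theorem edgeWeight_sq (x : ℝ) : edgeWeight α x ^ 2 = Real.sign x ^ 2 * (|x| ^ (-1 / α)) ^ 2 := by
  rw [edgeWeight, mul_pow]

theorem edgeWeight_sq_le (hα : 0 < α) {a x : ℝ} (ha : 0 < a) (hx : a ≤ |x|) :
    edgeWeight α x ^ 2 ≤ (a ^ (-1 / α)) ^ 2 := by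
  have h1 : Real.sign x ^ 2 ≤ 1 := by
    rcases Real.sign_apply_eq x with h | h | h <;> rw [h] <;> norm_num
  have h2 : |x| ^ (-1 / α) ≤ a ^ (-1 / α) :=
    Real.rpow_le_rpow_of_nonpos ha hx (div_nonpos_of_nonpos_of_nonneg (by norm_num) hα.le)
  rw [edgeWeight_sq]
  calc _ ≤ 1 * (|x| ^ (-1 / α)) ^ 2 := by gcongr
    _ ≤ _ := by rw [one_mul]; gcongr

/-- The exponent is 2/α > 1. -/
theorem summable_position_weight (hα : 0 < α) (hα2 : α < 2) :
    Summable fun k : ℕ => ((((k : ℝ) + 1) / 12) ^ (-1 / α)) ^ 2 := by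
  have h1 : Summable fun k : ℕ => (k : ℝ) ^ (-(2 / α)) :=
    Real.summable_nat_rpow.2 (by
      have : 1 < 2 / α := by rw [lt_div_iff₀ hα]; linarith
      linarith)
  have h2 := ((summable_nat_add_iff 1).2 h1).mul_right ((12 : ℝ)⁻¹ ^ (-(2 / α)))
  refine h2.congr fun k => ?_
  rw [← Real.rpow_natCast, ← Real.rpow_mul (by positivity), div_eq_mul_inv _ (12 : ℝ),
    Real.mul_rpow (by positivity) (by positivity)]
  push_cast
  have : -1 / α * 2 = -(2 / α) := by ring
  rw [this]

theorem append_singleton_injective (v : TreeVertex) :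
    Function.Injective fun k : ℕ => v ++ [k] := fun a b hab => by simpa using hab

/-- `HasSmallMark` looks at all later positions, so its failure at one `k` bounds every mark from
there on. It fails somewhere, since otherwise all one-letter words would be cluster words. -/
theorem HasFiniteClusters.treeColumnsSquareSummable (h : HasFiniteClusters t) (hα : 0 < α)
    (hα2 : α < 2) : TreeColumnsSquareSummable α t := by
  rw [treeColumnsSquareSummable_iff]
  intro w
  have hk : ∃ k, ¬ HasSmallMark t w k := by
    by_contra! hc
    refine Set.infinite_range_of_injective (append_singleton_injective []) ((h w).subset ?_)
    rintro _ ⟨k, rfl⟩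
    refine (isClusterWord_nil w).append ?_
    simpa using hc k
  obtain ⟨k, hk⟩ := hk
  have hchild : Summable fun j : ℕ => treeEntry α t (w ++ [j]) w ^ 2 := by
    refine (summable_nat_add_iff k).1 (((summable_nat_add_iff k).2
      (summable_position_weight hα hα2)).of_nonneg_of_le (fun j => sq_nonneg _) fun j => ?_)
    rw [treeEntry_child']
    refine edgeWeight_sq_le hα (by positivity) ?_
    by_contra! hlt
    exact hk ⟨j + k, by omega, hlt⟩
  classical
  have h1 : Summable fun v => if ∃ k, v = w ++ [k] then treeEntry α t v w ^ 2 else 0 := by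
    refine ((append_singleton_injective w).summable_iff fun v hv => ?_).1 ?_
    · rw [if_neg]
      rintro ⟨k, rfl⟩
      exact hv ⟨k, rfl⟩
    · simpa [Function.comp_def] using hchild
  refine (summable_congr_cofinite ?_).1 h1
  rw [EventuallyEq, eventually_cofinite]
  refine (Set.finite_singleton w.dropLast).subset fun v hv => ?_
  by_contra hne
  apply hv
  split_ifs with hc
  · rfl
  · have : treeEntry α t v w = 0 := by
      by_contra h0
      rcases exists_of_treeEntry_ne_zero h0 with ⟨j, hj⟩ | hj
      · exact hne (by simp [hj])
      · exact hc hj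
    simp [this]

/-- `S` is the union of the clusters attached to the prefixes of words in `F`. An edge leaving `S`
at position k extends no cluster, so its mark is at least (k + 1)/12; κ sums the corresponding
squared weights. -/
theorem HasFiniteClusters.treeConfined (h : HasFiniteClusters t) (hα : 0 < α)
    (hα2 : α < 2) : TreeConfined α t := by
  classical
  refine ⟨∑' k : ℕ, ((((k : ℝ) + 1) / 12) ^ (-1 / α)) ^ 2, fun F => ?_⟩
  let F' : Finset TreeVertex := F.biUnion fun v => v.inits.toFinset
  have hF' : ∀ v k, v ++ [k] ∈ F' → v ∈ F' := by
    intro v k hv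
    simp only [F', Finset.mem_biUnion, List.mem_toFinset, List.mem_inits] at hv ⊢
    obtain ⟨w, hw, hp⟩ := hv
    exact ⟨w, hw, (List.prefix_append v [k]).trans hp⟩
  let S : Finset TreeVertex := F'.biUnion fun v => (h v).toFinset.image (v ++ ·)
  have hmem : ∀ x, x ∈ S ↔ ∃ v ∈ F', ∃ u, IsClusterWord t v u ∧ v ++ u = x := by
    intro x
    simp [S]
  have hSub : F' ⊆ S := fun v hv =>
    (hmem v).2 ⟨v, hv, [], isClusterWord_nil v, List.append_nil v⟩
  have hS : ∀ v k, v ++ [k] ∈ S → v ∈ S := by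
    intro x k hx
    obtain ⟨v, hv, u, hu, hvu⟩ := (hmem _).1 hx
    rcases List.eq_nil_or_concat u with rfl | ⟨u', j, rfl⟩
    · rw [List.append_nil] at hvu
      exact hSub (hF' x k (hvu ▸ hv))
    · rw [List.concat_eq_append] at hvu hu
      rw [← List.append_assoc] at hvu
      exact (hmem x).2 ⟨v, hv, u', hu.of_append, (List.append_inj' hvu rfl).1⟩
  have hlate : ∀ v ∈ S, ∀ k, v ++ [k] ∉ S → ¬ HasSmallMark t v k := by
    intro x hx k hk hsm
    obtain ⟨v, hv, u, hu, rfl⟩ := (hmem _).1 hx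
    exact hk ((hmem _).2 ⟨v, hv, u ++ [k], hu.append hsm, (List.append_assoc _ _ _).symm⟩)
  refine ⟨S, fun v hv => hSub ?_, hS, fun v hv => ?_⟩
  · simp only [F', Finset.mem_biUnion, List.mem_toFinset, List.mem_inits]
    exact ⟨v, hv, List.prefix_refl v⟩
  · rw [← (append_singleton_injective v).tsum_eq]
    · have hle : ∀ k : ℕ, (if v ++ [k] ∈ S then 0 else treeEntry α t (v ++ [k]) v ^ 2) ≤
          ((((k : ℝ) + 1) / 12) ^ (-1 / α)) ^ 2 := by
        intro k
        split_ifs with hk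
        · positivity
        · rw [treeEntry_child']
          refine edgeWeight_sq_le hα (by positivity) ?_
          by_contra! hlt
          exact hlate v hv k hk ⟨k, le_rfl, hlt⟩
      have hs := summable_position_weight hα hα2
      exact Summable.tsum_le_tsum hle (hs.of_nonneg_of_le
        (fun k => by split_ifs; exacts [le_rfl, sq_nonneg _]) hle) hs
    · intro u hu
      rw [Function.mem_support] at hu
      split_ifs at hu with huS
      · exact absurd rfl hu
      · rcases exists_of_treeEntry_ne_zero (fun h0 => hu (by rw [h0]; norm_num)) with
          ⟨j, hj⟩ | ⟨j, hj⟩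
        · exact absurd (hS u j (hj ▸ hv)) huS
        · exact ⟨j, hj.symm⟩

theorem HasFiniteClusters.goodMarks (h : HasFiniteClusters t) (hα : 0 < α) (hα2 : α < 2) :
    GoodMarks α t :=
  ⟨h.treeColumnsSquareSummable hα hα2, h.treeConfined hα hα2⟩

end FiniteClusters

/-! ### The clusters of the Poisson weighted infinite tree -/

section Clusters

theorem tsum_list_prod_of_length (q : ℕ → ℝ≥0∞) (n : ℕ) :
    ∑' u : List ℕ, (if u.length = n then (u.map q).prod else 0) = (∑' k, q k) ^ n := by
  induction n with
  | zero =>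
    rw [tsum_eq_single []]
    · simp
    · intro u hu
      rw [if_neg (by simpa using hu)]
  | succ n ih =>
    have hinj : Function.Injective fun p : ℕ × List ℕ => p.1 :: p.2 := fun a b hab => by
      simp only [List.cons.injEq] at hab
      exact Prod.ext hab.1 hab.2
    rw [← hinj.tsum_eq, ENNReal.tsum_prod', pow_succ', ← ih, ← ENNReal.tsum_mul_right]
    · refine tsum_congr fun k => ?_
      rw [← ENNReal.tsum_mul_left]
      refine tsum_congr fun u => ?_
      simp
    · intro u hu
      cases u with
      | nil => simp at hu
      | cons k u => exact ⟨(k, u), rfl⟩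

theorem tsum_list_prod (q : ℕ → ℝ≥0∞) :
    ∑' u : List ℕ, (u.map q).prod = ∑' n, (∑' k, q k) ^ n := by
  simp_rw [← tsum_list_prod_of_length]
  rw [ENNReal.tsum_comm]
  refine tsum_congr fun u => ?_
  rw [tsum_eq_single u.length]
  · simp
  · intro n hn
    rw [if_neg hn.symm]

theorem twoSidedLebesgue_abs_lt {θ : ℝ} (hθ : 0 ≤ θ) (hθ1 : θ ≤ 1) (r : ℝ) :
    twoSidedLebesgue θ {x | |x| < r} = ENNReal.ofReal r := by
  have hm : MeasurableSet {x : ℝ | |x| < r} := measurableSet_lt (by fun_prop) (by fun_prop)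
  have h1 : {x : ℝ | |x| < r} ∩ Ioi 0 = Ioo 0 r := by
    ext x
    simp only [mem_inter_iff, mem_ofPred_eq, mem_Ioi, mem_Ioo, abs_lt]
    constructor
    · rintro ⟨⟨-, h⟩, h'⟩; exact ⟨h', h⟩
    · rintro ⟨h, h'⟩; exact ⟨⟨by linarith, h'⟩, h⟩
  have h2 : {x : ℝ | |x| < r} ∩ Iio 0 = Ioo (-r) 0 := by
    ext x
    simp only [mem_inter_iff, mem_ofPred_eq, mem_Iio, mem_Ioo, abs_lt]
    constructor
    · rintro ⟨⟨h, -⟩, h'⟩; exact ⟨h, h'⟩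
    · rintro ⟨h, h'⟩; exact ⟨⟨h, by linarith⟩, h'⟩
  rw [twoSidedLebesgue, Measure.add_apply, Measure.smul_apply, Measure.smul_apply,
    Measure.restrict_apply hm, Measure.restrict_apply hm, h1, h2, Real.volume_Ioo, Real.volume_Ioo,
    smul_eq_mul, smul_eq_mul, sub_zero, sub_neg_eq_add, zero_add, ← add_mul,
    ← ENNReal.ofReal_add hθ (by linarith)]
  simp

variable {Ω : Type*} [MeasurableSpace Ω] {P : Measure Ω}
  {y : TreeVertex → Ω → ℝ} {θ : ℝ}

/-- By the ordering, |y_{vj}| < r forces j + 1 points into {|x| < r}, whose number is Poisson of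
mean r. -/
theorem IsPWIT.measure_abs_lt_le (hy : IsPWIT P (twoSidedLebesgue θ) y) (hθ : 0 ≤ θ)
    (hθ1 : θ ≤ 1) (v : TreeVertex) (j : ℕ) {r : ℝ} (hr : 0 ≤ r) :
    P {ω | |y (v ++ [j]) ω| < r} ≤ ENNReal.ofReal (r ^ (j + 1) / (j + 1).factorial) := by
  have hm : MeasurableSet {x : ℝ | |x| < r} := measurableSet_lt (by fun_prop) (by fun_prop)
  have hν := twoSidedLebesgue_abs_lt hθ hθ1 r
  have hlaw := (hy.poisson v).hasLaw_count _ hm (by rw [hν]; exact ENNReal.ofReal_ne_top)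
  rw [hν] at hlaw
  have h1 : P {ω | |y (v ++ [j]) ω| < r} ≤ P {ω | ((j + 1 : ℕ) : ℕ∞) ≤
      pointCount (fun k => y (v ++ [k])) {x : ℝ | |x| < r} ω} := by
    refine measure_mono_ae ?_
    filter_upwards [hy.ordered v] with ω hω hj
    have hsub : ((Finset.range (j + 1) : Finset ℕ) : Set ℕ) ⊆
        {k | y (v ++ [k]) ω ∈ {x : ℝ | |x| < r}} := by
      intro i hi
      exact (hω (Nat.lt_succ_iff.1 (Finset.mem_range.1 (Finset.mem_coe.1 hi)))).trans_lt hj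
    have := Set.encard_le_encard hsub
    rwa [Set.encard_coe_eq_coe_finsetCard, Finset.card_range] at this
  refine h1.trans ?_
  rw [hlaw.measure_eq (p := fun n => ((j + 1 : ℕ) : ℕ∞) ≤ n) .of_discrete,
    Measure.map_apply .of_discrete .of_discrete]
  have h2 : (Nat.cast : ℕ → ℕ∞) ⁻¹' {x | ((j + 1 : ℕ) : ℕ∞) ≤ x} = Ici (j + 1) := by
    ext n
    simp only [mem_preimage, mem_ofPred_eq, mem_Ici, Nat.cast_le]
  rw [h2]
  refine (poissonMeasure_Ici_le _ _).trans_eq ?_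
  rw [ENNReal.coe_toNNReal_eq_toReal, ENNReal.toReal_ofReal hr]

/-- The constant 12 is chosen for nⁿ/n! ≤ eⁿ ≤ 3ⁿ and 3/12 = 1/4. -/
theorem pow_div_factorial_le (n : ℕ) :
    ((n : ℝ) / 12) ^ n / n.factorial ≤ (1 / 4) ^ n := by
  have h1 : (n : ℝ) ^ n / n.factorial ≤ Real.exp n :=
    Real.pow_div_factorial_le_exp n (Nat.cast_nonneg n) n
  have h2 : Real.exp n ≤ 3 ^ n := by
    rw [← Real.exp_one_pow]
    have := Real.exp_one_lt_d9
    gcongr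
    linarith
  calc ((n : ℝ) / 12) ^ n / n.factorial = (n : ℝ) ^ n / n.factorial * (1 / 12) ^ n := by
        rw [div_eq_mul_one_div (n : ℝ) 12, mul_pow]; ring
    _ ≤ 3 ^ n * (1 / 12) ^ n := by gcongr; exact h1.trans h2
    _ = _ := by rw [← mul_pow]; norm_num

theorem hasSum_quarter_pow (k : ℕ) :
    HasSum (fun i : ℕ => (1 / 4 : ℝ) ^ (k + i + 1)) (1 / 3 * (1 / 4) ^ k) := by
  have h := (hasSum_geometric_of_lt_one (r := (1 / 4 : ℝ)) (by norm_num) (by norm_num)).mul_left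
    ((1 / 4 : ℝ) ^ (k + 1))
  have h1 : (1 / 4 : ℝ) ^ (k + 1) * (1 - 1 / 4)⁻¹ = 1 / 3 * (1 / 4) ^ k := by
    rw [pow_succ]; ring
  rw [h1] at h
  have h2 : (fun i : ℕ => (1 / 4 : ℝ) ^ (k + 1) * (1 / 4) ^ i) =
      fun i => (1 / 4 : ℝ) ^ (k + i + 1) :=
    funext fun i => by rw [← pow_add]; congr 1; omega
  rwa [h2] at h

theorem IsPWIT.measure_hasSmallMark_le (hy : IsPWIT P (twoSidedLebesgue θ) y) (hθ : 0 ≤ θ)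
    (hθ1 : θ ≤ 1) (v : TreeVertex) (k : ℕ) :
    P {ω | HasSmallMark (fun w => y w ω) v k} ≤ ENNReal.ofReal (1 / 3 * (1 / 4) ^ k) := by
  have hU : {ω | HasSmallMark (fun w => y w ω) v k} ⊆
      ⋃ i : ℕ, {ω | |y (v ++ [k + i]) ω| < ((k + i : ℕ) + 1 : ℝ) / 12} := by
    rintro ω ⟨j, hj, hlt⟩
    refine mem_iUnion.2 ⟨j - k, ?_⟩
    have : k + (j - k) = j := by omega
    rw [this]
    exact hlt
  refine (measure_mono hU).trans ((measure_iUnion_le _).trans ?_)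
  have hs := hasSum_quarter_pow k
  rw [← hs.tsum_eq, ENNReal.ofReal_tsum_of_nonneg (fun i => by positivity) hs.summable]
  refine ENNReal.tsum_le_tsum fun i => ?_
  refine (hy.measure_abs_lt_le hθ hθ1 v (k + i) (by positivity)).trans
    (ENNReal.ofReal_le_ofReal ?_)
  have := pow_div_factorial_le (k + i + 1)
  push_cast at this ⊢
  exact this

/-- The event is an intersection over the distinct vertices on the path from `v`, whose mark rows
are independent. -/
theorem IsPWIT.measure_isClusterWord_le (hy : IsPWIT P (twoSidedLebesgue θ) y) (hθ : 0 ≤ θ)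
    (hθ1 : θ ≤ 1) (v u : TreeVertex) :
    P {ω | IsClusterWord (fun w => y w ω) v u} ≤
      (u.map fun k => ENNReal.ofReal (1 / 3 * (1 / 4) ^ k)).prod := by
  let A : ℕ → Set (ℕ → ℝ) := fun k => {x | ∃ j ≥ k, |x j| < (j + 1) / 12}
  have hA : ∀ k, MeasurableSet (A k) := by
    intro k
    have : A k = ⋃ j, ⋃ (_ : j ≥ k), {x : ℕ → ℝ | |x j| < (j + 1) / 12} := by
      ext x
      simp [A]
    rw [this]
    refine MeasurableSet.iUnion fun j => MeasurableSet.iUnion fun _ => ?_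
    exact measurableSet_lt (measurable_pi_apply j).abs measurable_const
  have hinj : Function.Injective fun i : Fin u.length => v ++ u.take i := by
    intro a b hab
    have := congrArg List.length hab
    simp at this
    exact Fin.ext (by omega)
  have hind := hy.indep.precomp hinj
  have h1 := hind.measure_inter_preimage_eq_mul Finset.univ
    (sets := fun i => A u[i]) fun i _ => hA _
  have h2 : {ω | IsClusterWord (fun w => y w ω) v u} =
      ⋂ i ∈ (Finset.univ : Finset (Fin u.length)),
        (fun ω k => y (v ++ u.take i ++ [k]) ω) ⁻¹' A u[i] := by
    ext ω
    simp only [Finset.mem_univ, iInter_true, mem_iInter, mem_preimage]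
    exact ⟨fun h i => h i i.2, fun h i hi => h ⟨i, hi⟩⟩
  have h3 : (u.map fun k => ENNReal.ofReal (1 / 3 * (1 / 4) ^ k)).prod =
      ∏ i : Fin u.length, ENNReal.ofReal (1 / 3 * (1 / 4) ^ u[i]) :=
    (Fin.prod_univ_fun_getElem u _).symm
  rw [h2, h3]
  refine h1.trans_le (Finset.prod_le_prod' fun i _ => ?_)
  exact hy.measure_hasSmallMark_le hθ hθ1 (v ++ u.take i) u[i]

/-- First moment and Borel–Cantelli: the expected cluster size is at most ∑ₙ (4/9)ⁿ, as ∑ₖ (1/3) 4⁻ᵏ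
= 4/9. -/
theorem IsPWIT.ae_hasFiniteClusters (hy : IsPWIT P (twoSidedLebesgue θ) y) (hθ : 0 ≤ θ)
    (hθ1 : θ ≤ 1) : ∀ᵐ ω ∂P, HasFiniteClusters fun w => y w ω := by
  refine ae_all_iff.2 fun v => ae_finite_setOfPred_mem (s := fun u =>
    {ω | IsClusterWord (fun w => y w ω) v u}) ?_
  refine ne_top_of_le_ne_top ?_ (ENNReal.tsum_le_tsum fun u =>
    hy.measure_isClusterWord_le hθ hθ1 v u)
  have hs : HasSum (fun k : ℕ => 1 / 3 * (1 / 4 : ℝ) ^ k) (4 / 9) := by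
    have h := (hasSum_geometric_of_lt_one (r := (1 / 4 : ℝ)) (by norm_num)
      (by norm_num)).mul_left (1 / 3 : ℝ)
    norm_num at h ⊢
    exact h
  rw [tsum_list_prod, ← ENNReal.ofReal_tsum_of_nonneg (fun k => by positivity) hs.summable,
    hs.tsum_eq, ENNReal.tsum_geometric]
  simp only [ne_eq, ENNReal.inv_eq_top, tsub_eq_zero_iff_le, not_le]
  rw [← ENNReal.ofReal_one]
  exact (ENNReal.ofReal_lt_ofReal_iff one_pos).2 (by norm_num)

end Clusters

/-! ### The squared weights form a Poisson process of stable intensity -/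

section StableIntensity

variable {α : ℝ}

theorem measurable_edgeWeight_sq : Measurable fun x : ℝ => edgeWeight α x ^ 2 := by
  have h : Measurable Real.sign :=
    Measurable.ite measurableSet_Iio measurable_const
      (Measurable.ite measurableSet_Ioi measurable_const measurable_const)
  exact (h.mul (measurable_id.abs.pow_const _)).pow_const 2

theorem edgeWeight_sq_of_pos {x : ℝ} (hx : 0 < x) : edgeWeight α x ^ 2 = x ^ (-(2 / α)) := by
  rw [edgeWeight_sq, Real.sign_of_pos hx, abs_of_pos hx, ← Real.rpow_natCast,
    ← Real.rpow_natCast, ← Real.rpow_mul hx.le]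
  have : -1 / α * (2 : ℕ) = -(2 / α) := by push_cast; ring
  rw [this]
  simp

theorem edgeWeight_sq_neg (x : ℝ) : edgeWeight α (-x) ^ 2 = edgeWeight α x ^ 2 := by
  rw [edgeWeight_sq, edgeWeight_sq, Real.sign_neg, abs_neg, neg_sq]

theorem stableIntensity_apply {B : Set ℝ} (hB : MeasurableSet B) : stableIntensity α B =
    ∫⁻ x in Ioi 0, B.indicator (fun x => ENNReal.ofReal (α / 2 * x ^ (-(α / 2) - 1))) x := by
  rw [stableIntensity, withDensity_apply _ hB, lintegral_indicator hB]

/-- Substituting x = t^(-2/α) on (0, ∞), the density times the Jacobian is 1. -/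
theorem stableIntensity_eq_volume (hα : 0 < α) {B : Set ℝ} (hB : MeasurableSet B) :
    stableIntensity α B = volume (((fun x => edgeWeight α x ^ 2) ⁻¹' B) ∩ Ioi 0) := by
  have hexp : -(2 / α) ≠ 0 := by
    have : 0 < 2 / α := by positivity
    linarith
  have himg : (fun t : ℝ => t ^ (-(2 / α))) '' Ioi 0 = Ioi 0 := by
    ext x
    constructor
    · rintro ⟨t, ht, rfl⟩
      exact Real.rpow_pos_of_pos ht _
    · intro hx
      refine ⟨x ^ (-(2 / α))⁻¹, Real.rpow_pos_of_pos hx _, ?_⟩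
      change (x ^ (-(2 / α))⁻¹) ^ (-(2 / α)) = x
      rw [← Real.rpow_mul (le_of_lt hx), inv_mul_cancel₀ hexp, Real.rpow_one]
  have hinj : InjOn (fun t : ℝ => t ^ (-(2 / α))) (Ioi 0) := by
    intro a ha b hb hab
    have := congrArg (fun x : ℝ => x ^ (-(2 / α))⁻¹) hab
    simp only at this
    rwa [← Real.rpow_mul (le_of_lt ha), ← Real.rpow_mul (le_of_lt hb), mul_inv_cancel₀ hexp,
      Real.rpow_one, Real.rpow_one] at this
  rw [stableIntensity_apply hB, ← himg, lintegral_image_eq_lintegral_abs_deriv_mul measurableSet_Ioi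
    (f' := fun t => -(2 / α) * t ^ (-(2 / α) - 1))
    (fun t ht => (Real.hasDerivAt_rpow_const (Or.inl (ne_of_gt ht))).hasDerivWithinAt) hinj, himg,
    ← Measure.restrict_apply (measurable_edgeWeight_sq hB),
    ← lintegral_indicator_one (measurable_edgeWeight_sq hB)]
  refine setLIntegral_congr_fun measurableSet_Ioi fun t ht => ?_
  have ht' : (0 : ℝ) < t := ht
  have hmem : t ∈ (fun x => edgeWeight α x ^ 2) ⁻¹' B ↔ t ^ (-(2 / α)) ∈ B := by
    rw [mem_preimage, edgeWeight_sq_of_pos ht']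
  by_cases h : t ^ (-(2 / α)) ∈ B
  · rw [indicator_of_mem h, indicator_of_mem (hmem.2 h), ← ENNReal.ofReal_mul (abs_nonneg _),
      Pi.one_apply, ← ENNReal.ofReal_one]
    congr 1
    have hp : 0 < 2 / α := by positivity
    rw [abs_mul, abs_neg, abs_of_pos hp, abs_of_pos (Real.rpow_pos_of_pos ht' _),
      ← Real.rpow_mul ht'.le]
    have h1 : t ^ (-(2 / α) - 1) * t ^ (-(2 / α) * (-(α / 2) - 1)) = 1 := by
      rw [← Real.rpow_add ht']
      have : -(2 / α) - 1 + -(2 / α) * (-(α / 2) - 1) = 0 := by field_simp; ring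
      rw [this, Real.rpow_zero]
    calc _ = (2 / α * (α / 2)) *
          (t ^ (-(2 / α) - 1) * t ^ (-(2 / α) * (-(α / 2) - 1))) := by ring
      _ = 1 := by rw [h1]; field_simp
  · rw [indicator_of_notMem h, indicator_of_notMem (fun h' => h (hmem.1 h')), mul_zero]

/-- The squared weight is even, so the half-lines contribute shares θ and 1 - θ of the same value.
-/
theorem map_twoSidedLebesgue {θ : ℝ} (hα : 0 < α) (hθ : 0 ≤ θ) (hθ1 : θ ≤ 1) :
    (twoSidedLebesgue θ).map (fun x => edgeWeight α x ^ 2) = stableIntensity α := by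
  ext B hB
  have hm := measurable_edgeWeight_sq (α := α) hB
  rw [Measure.map_apply measurable_edgeWeight_sq hB, stableIntensity_eq_volume hα hB,
    twoSidedLebesgue, Measure.add_apply, Measure.smul_apply, Measure.smul_apply,
    Measure.restrict_apply hm, Measure.restrict_apply hm]
  have hneg : (fun x => edgeWeight α x ^ 2) ⁻¹' B ∩ Iio 0 =
      Neg.neg ⁻¹' ((fun x => edgeWeight α x ^ 2) ⁻¹' B ∩ Ioi 0) := by
    ext x
    simp [edgeWeight_sq_neg]
  rw [hneg, Measure.measure_preimage_neg, smul_eq_mul, smul_eq_mul, ← add_mul,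
    ← ENNReal.ofReal_add hθ (by linarith)]
  simp

theorem isSummableIntensity_stableIntensity (hα : 0 < α) (hα2 : α < 2) :
    IsSummableIntensity (stableIntensity α) where
  sigmaFinite := by
    unfold stableIntensity
    exact SigmaFinite.withDensity_ofReal _
  nonpos := by
    rw [stableIntensity_eq_volume hα measurableSet_Iic]
    convert measure_empty (μ := volume (α := ℝ))
    ext x
    simp only [mem_inter_iff, mem_preimage, mem_Iic, mem_Ioi, mem_empty_iff_false, iff_false]
    rintro ⟨h, hx⟩
    rw [edgeWeight_sq_of_pos hx] at h
    exact absurd h (not_le.2 (Real.rpow_pos_of_pos hx _))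
  tail a ha := by
    have hint : IntegrableOn (fun x : ℝ => α / 2 * x ^ (-(α / 2) - 1)) (Ioi (a / 2)) :=
      (integrableOn_Ioi_rpow_of_lt (by linarith) (by positivity)).const_mul _
    rw [stableIntensity, withDensity_apply _ measurableSet_Ici,
      Measure.restrict_restrict measurableSet_Ici]
    refine ne_top_of_le_ne_top hint.lintegral_lt_top.ne (lintegral_mono_set fun x hx => ?_)
    have : a ≤ x := hx.1
    rw [mem_Ioi]
    linarith
  small := by
    -- Integrability at 0 amounts to α/2 < 1.
    have hint : IntegrableOn (fun x : ℝ => α / 2 * x ^ (-(α / 2))) (Ioc 0 1) := by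
      have := (intervalIntegral.intervalIntegrable_rpow' (a := 0) (b := 1) (r := -(α / 2))
        (by linarith)).const_mul (α / 2)
      rwa [intervalIntegrable_iff_integrableOn_Ioc_of_le zero_le_one] at this
    rw [stableIntensity, restrict_withDensity measurableSet_Iic,
      lintegral_withDensity_eq_lintegral_mul _ (by fun_prop) ENNReal.measurable_ofReal,
      Measure.restrict_restrict measurableSet_Iic]
    have hset : Iic (1 : ℝ) ∩ Ioi 0 = Ioc 0 1 := by
      rw [inter_comm, Ioi_inter_Iic]
    rw [hset]
    refine ne_top_of_le_ne_top hint.lintegral_lt_top.ne (le_of_eq ?_)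
    refine setLIntegral_congr_fun measurableSet_Ioc fun x hx => ?_
    rw [Pi.mul_apply, ← ENNReal.ofReal_mul (by have := hx.1; positivity), mul_assoc,
      ← Real.rpow_add_one hx.1.ne']
    congr 3
    ring

end StableIntensity

/-! ### Independence of the subtrees -/

section Independence

/-- Independence says that the joint law is a product over ι × κ; currying turns it into a product
over ι of the row laws. -/
theorem iIndepFun_curry {Ω ι κ X : Type*} [MeasurableSpace Ω] [MeasurableSpace X] {P : Measure Ω}
    [IsProbabilityMeasure P] {Y : ι × κ → Ω → X} (hY : ∀ p, Measurable (Y p))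
    (h : iIndepFun Y P) : iIndepFun (fun i ω j => Y (i, j) ω) P := by
  have hprob : ∀ p, IsProbabilityMeasure (P.map (Y p)) := fun p =>
    Measure.isProbabilityMeasure_map (hY p).aemeasurable
  have hrow : ∀ i, Measurable fun ω j => Y (i, j) ω := fun i =>
    measurable_pi_lambda _ fun j => hY (i, j)
  rw [iIndepFun_iff_map_fun_eq_infinitePi_map hrow]
  have h1 := (iIndepFun_iff_map_fun_eq_infinitePi_map hY).1 h
  have h2 : ∀ i, P.map (fun ω j => Y (i, j) ω) = Measure.infinitePi fun j => P.map (Y (i, j)) :=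
    fun i => (iIndepFun_iff_map_fun_eq_infinitePi_map fun j => hY (i, j)).1
      (h.precomp (Prod.mk_right_injective i))
  simp only [h2]
  rw [← Measure.infinitePi_map_curry (fun i j => P.map (Y (i, j)))]
  have h3 : (fun ω i j => Y (i, j) ω) = MeasurableEquiv.curry ι κ X ∘ fun ω p => Y p ω := rfl
  rw [h3, ← Measure.map_map (MeasurableEquiv.measurable _) (measurable_pi_lambda _ hY), h1]

variable {Ω : Type*} [MeasurableSpace Ω] {P : Measure Ω} {y : TreeVertex → Ω → ℝ} {ν : Measure ℝ}

/-- The marks below each vertex. -/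
def markRows (y : TreeVertex → Ω → ℝ) (ω : Ω) : TreeVertex → ℕ → ℝ := fun v j => y (v ++ [j]) ω

theorem IsPWIT.subtree (hy : IsPWIT P ν y) (k : ℕ) : IsPWIT P ν fun v => y (k :: v) where
  poisson v := hy.poisson (k :: v)
  ordered v := hy.ordered (k :: v)
  indep := hy.indep.precomp (g := List.cons k) List.cons_injective

theorem IsPWIT.measurable_markRows (hy : IsPWIT P ν y) : Measurable (markRows y) :=
  measurable_pi_lambda _ fun v => measurable_pi_lambda _ fun j => (hy.poisson v).measurable j

theorem cons_uncurry_injective :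
    Function.Injective fun p : ℕ × TreeVertex => (p.1 :: p.2 : TreeVertex) := fun a b hab => by
  simp only [List.cons.injEq] at hab
  exact Prod.ext hab.1 hab.2

theorem IsPWIT.measurable_row (hy : IsPWIT P ν y) (v : TreeVertex) :
    Measurable fun ω j => y (v ++ [j]) ω :=
  measurable_pi_lambda _ fun j => (hy.poisson v).measurable j

theorem IsPWIT.iIndepFun_subtrees [IsProbabilityMeasure P] (hy : IsPWIT P ν y) :
    iIndepFun (fun k ω => markRows (fun v => y (k :: v)) ω) P :=
  iIndepFun_curry (Y := fun (p : ℕ × TreeVertex) ω j => y (p.1 :: p.2 ++ [j]) ω)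
    (fun p => hy.measurable_row (p.1 :: p.2)) (hy.indep.precomp cons_uncurry_injective)

/-- The two sides are generated by mark rows of disjoint vertex sets: the non-root vertices and the
root. -/
theorem IsPWIT.indepFun_subtrees_root (hy : IsPWIT P ν y) :
    IndepFun (fun ω k => markRows (fun v => y (k :: v)) ω) (fun ω j => y [j] ω) P := by
  have h := indep_iSup_of_disjoint (fun v => (hy.measurable_row v).comap_le) hy.indep
    (S := {v | v ≠ []}) (T := {[]}) (by simp)
  refine indep_of_indep_of_le_left (indep_of_indep_of_le_right h ?_) ?_
  · exact le_iSup₂_of_le (f := fun v (_ : v ∈ ({[]} : Set TreeVertex)) =>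
      MeasurableSpace.comap (fun ω j => y (v ++ [j]) ω) inferInstance) [] rfl le_rfl
  · rw [← measurable_iff_comap_le]
    refine @measurable_pi_lambda _ _ _ (_) _ _ fun k =>
      @measurable_pi_lambda _ _ _ (_) _ _ fun v => ?_
    rw [measurable_iff_comap_le]
    exact le_iSup₂_of_le (f := fun v (_ : v ∈ ({v | v ≠ []} : Set TreeVertex)) =>
      MeasurableSpace.comap (fun ω j => y (v ++ [j]) ω) inferInstance) (k :: v) (by simp) le_rfl

theorem IsPWIT.isMarkedPoisson [IsProbabilityMeasure P] {α θ : ℝ} (hα : 0 < α) (hθ : 0 ≤ θ)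
    (hθ1 : θ ≤ 1) (hy : IsPWIT P (twoSidedLebesgue θ) y)
    {G : (TreeVertex → ℕ → ℝ) → ℂ} (hG : Measurable G) {μ : Measure ℂ}
    (hlaw : ∀ k, HasLaw (fun ω => G (markRows (fun v => y (k :: v)) ω)) μ P) :
    IsMarkedPoisson P (fun k ω => edgeWeight α (y [k] ω) ^ 2)
      (fun k ω => G (markRows (fun v => y (k :: v)) ω)) (stableIntensity α) μ where
  poisson := by
    rw [← map_twoSidedLebesgue hα hθ hθ1]
    exact (hy.poisson []).map measurable_edgeWeight_sq
  hasLaw := hlaw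
  indep := hy.iIndepFun_subtrees.comp (fun _ => G) fun _ => hG
  indep_points := hy.indepFun_subtrees_root.comp
    (φ := fun (x : ℕ → TreeVertex → ℕ → ℝ) k => G (x k))
    (ψ := fun (x : ℕ → ℝ) k => edgeWeight α (x k) ^ 2)
    (measurable_pi_lambda _ fun k => hG.comp (measurable_pi_apply k))
    (measurable_pi_lambda _ fun k => measurable_edgeWeight_sq.comp (measurable_pi_apply k))

end Independence

/-! ### The law of the root resolvent -/

section Law

variable {α : ℝ}

/-- The marks with prescribed rows, and root mark `0`. -/
def ofMarkRows (x : TreeVertex → ℕ → ℝ) : TreeVertex → ℝ :=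
  fun v => if v = [] then 0 else x v.dropLast (v.getLastD 0)

theorem ofMarkRows_append (x : TreeVertex → ℕ → ℝ) (v : TreeVertex) (j : ℕ) :
    ofMarkRows x (v ++ [j]) = x v j := by
  simp [ofMarkRows]

theorem measurable_ofMarkRows : Measurable ofMarkRows := by
  refine measurable_pi_lambda _ fun v => ?_
  unfold ofMarkRows
  split_ifs
  · exact measurable_const
  · exact (measurable_pi_apply _).comp (measurable_pi_apply _)

/-- The root mark never enters, so its arbitrary value in `ofMarkRows` is harmless. -/
theorem depthResolvent_congr {z : ℂ} {t t' : TreeVertex → ℝ}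
    (h : ∀ v j, t (v ++ [j]) = t' (v ++ [j]))
    (n : ℕ) : depthResolvent α z n t = depthResolvent α z n t' := by
  cases n with
  | zero => rfl
  | succ n =>
    have hsub : ∀ k, subMarks t k = subMarks t' k := by
      intro k
      funext v
      rcases List.eq_nil_or_concat v with rfl | ⟨u, j, rfl⟩
      · exact h [] k
      · rw [List.concat_eq_append]
        exact h (k :: u) j
    have hroot : ∀ k, t [k] = t' [k] := h []
    simp only [depthResolvent, hsub, hroot]

theorem measurable_depthResolvent (z : ℂ) (n : ℕ) : Measurable (depthResolvent α z n) := by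
  induction n with
  | zero => exact measurable_const
  | succ n ih =>
    refine ((Measurable.tsum fun k => ?_).const_add z).inv.neg
    have h1 : Measurable fun t : TreeVertex → ℝ => edgeWeight α (t [k]) ^ 2 :=
      measurable_edgeWeight_sq.comp (measurable_pi_apply _)
    have h2 : Measurable fun t : TreeVertex → ℝ => subMarks t k :=
      measurable_pi_lambda _ fun v => measurable_pi_apply _
    exact (Complex.measurable_ofReal.comp h1).mul (ih.comp h2)

theorem depthResolvent_ofMarkRows {Ω : Type*} (y : TreeVertex → Ω → ℝ) (z : ℂ) (n : ℕ) (ω : Ω) :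
    depthResolvent α z n (ofMarkRows (markRows y ω)) = depthResolvent α z n fun v => y v ω :=
  depthResolvent_congr (fun v j => ofMarkRows_append (markRows y ω) v j) n

/-- The limit of the root resolvents of the truncated trees. -/
def limitResolvent (α : ℝ) (z : ℂ) (x : TreeVertex → ℕ → ℝ) : ℂ :=
  limUnder atTop fun n => depthResolvent α z n (ofMarkRows x)

theorem measurable_limitResolvent (z : ℂ) : Measurable (limitResolvent α z) :=
  (StronglyMeasurable.limUnder fun n =>
    ((measurable_depthResolvent z n).comp measurable_ofMarkRows).stronglyMeasurable).measurable

theorem GoodMarks.limitResolvent_eq {Ω : Type*} {y : TreeVertex → Ω → ℝ} {ω : Ω}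
    (h : GoodMarks α fun v => y v ω) {z : ℂ} (hz : z.im ≠ 0) :
    limitResolvent α z (markRows y ω) = rootResolvent α (fun v => y v ω) z := by
  unfold limitResolvent
  simp only [depthResolvent_ofMarkRows]
  exact (h.tendsto_depthResolvent hz).limUnder_eq

variable {Ω : Type*} [MeasurableSpace Ω] {P : Measure Ω}
  {y y' : TreeVertex → Ω → ℝ} {θ : ℝ} {z : ℂ}

theorem IsPWIT.ae_goodMarks (hy : IsPWIT P (twoSidedLebesgue θ) y) (hα : 0 < α) (hα2 : α < 2)
    (hθ : 0 ≤ θ) (hθ1 : θ ≤ 1) : ∀ᵐ ω ∂P, GoodMarks α fun v => y v ω := by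
  filter_upwards [hy.ae_hasFiniteClusters hθ hθ1] with ω hω using hω.goodMarks hα hα2

theorem IsPWIT.aemeasurable_depthResolvent (hy : IsPWIT P (twoSidedLebesgue θ) y) (n : ℕ) :
    AEMeasurable (fun ω => depthResolvent α z n fun v => y v ω) P := by
  simp_rw [← depthResolvent_ofMarkRows y]
  exact (((measurable_depthResolvent z n).comp measurable_ofMarkRows).comp
    hy.measurable_markRows).aemeasurable

/-- Induction over all PWITs at once: subtrees are PWITs, so at depth n all subtrees of both trees
share one law, which serves as the common mark law in `identDistrib_tsum`. -/
theorem IsPWIT.identDistrib_depthResolvent [IsProbabilityMeasure P] (hα : 0 < α)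
    (hα2 : α < 2) (hθ : 0 ≤ θ) (hθ1 : θ ≤ 1) (hz : 0 < z.im) (n : ℕ) (hy : IsPWIT P (twoSidedLebesgue θ) y)
    (hy' : IsPWIT P (twoSidedLebesgue θ) y') :
    IdentDistrib (fun ω => depthResolvent α z n fun v => y v ω)
      (fun ω => depthResolvent α z n fun v => y' v ω) P P := by
  induction n generalizing y y' with
  | zero => exact IdentDistrib.refl aemeasurable_const
  | succ n ih =>
    have hmarked : ∀ {x : TreeVertex → Ω → ℝ}, IsPWIT P (twoSidedLebesgue θ) x →
        IsMarkedPoisson P (fun k ω => edgeWeight α (x [k] ω) ^ 2)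
          (fun k ω => depthResolvent α z n fun v => x (k :: v) ω) (stableIntensity α)
          (P.map fun ω => depthResolvent α z n fun v => y (0 :: v) ω) := by
      intro x hx
      have := hx.isMarkedPoisson hα hθ hθ1
        (G := fun r => depthResolvent α z n (ofMarkRows r))
        ((measurable_depthResolvent z n).comp measurable_ofMarkRows)
        (μ := P.map fun ω => depthResolvent α z n fun v => y (0 :: v) ω) ?_
      · simpa only [depthResolvent_ofMarkRows] using this
      · intro k
        simp only [depthResolvent_ofMarkRows]
        exact ⟨(hx.subtree k).aemeasurable_depthResolvent n,
          (ih (hx.subtree k) (hy.subtree 0)).map_eq⟩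
    have hbound : ∀ᵐ w ∂(P.map fun ω => depthResolvent α z n fun v => y (0 :: v) ω),
        ‖w‖ ≤ 1 / z.im := by
      rw [ae_map_iff ((hy.subtree 0).aemeasurable_depthResolvent n)
        (measurableSet_le measurable_norm measurable_const)]
      exact ae_of_all _ fun ω => (depthResolvent_bound hz n _).2
    have h := (hmarked hy).identDistrib_tsum (hmarked hy')
      (isSummableIntensity_stableIntensity hα hα2) hbound
    simp only [Complex.real_smul] at h
    exact h.comp (u := fun w => -(z + w)⁻¹) (measurable_id.const_add z).inv.neg

theorem IsPWIT.aemeasurable_rootResolvent (hα : 0 < α) (hα2 : α < 2) (hθ : 0 ≤ θ) (hθ1 : θ ≤ 1)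
    (hz : 0 < z.im) (hy : IsPWIT P (twoSidedLebesgue θ) y) :
    AEMeasurable (fun ω => rootResolvent α (fun v => y v ω) z) P := by
  refine aemeasurable_of_tendsto_metrizable_ae atTop
    (fun n => hy.aemeasurable_depthResolvent (z := z) (α := α) n) ?_
  filter_upwards [hy.ae_goodMarks hα hα2 hθ hθ1] with ω hω
  exact hω.tendsto_depthResolvent hz.ne'

/-- Characteristic functions agree at every finite depth and pass to the limit. This gives the
subtree resolvents the law of h(z). -/
theorem IsPWIT.identDistrib_rootResolvent [IsProbabilityMeasure P] (hα : 0 < α)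
    (hα2 : α < 2) (hθ : 0 ≤ θ) (hθ1 : θ ≤ 1) (hz : 0 < z.im) (hy : IsPWIT P (twoSidedLebesgue θ) y)
    (hy' : IsPWIT P (twoSidedLebesgue θ) y') :
    IdentDistrib (fun ω => rootResolvent α (fun v => y v ω) z)
      (fun ω => rootResolvent α (fun v => y' v ω) z) P P := by
  have hm := hy.aemeasurable_rootResolvent hα hα2 hθ hθ1 hz
  have hm' := hy'.aemeasurable_rootResolvent hα hα2 hθ hθ1 hz
  refine ⟨hm, hm', ?_⟩
  have := Measure.isProbabilityMeasure_map hm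
  have := Measure.isProbabilityMeasure_map hm'
  refine Measure.ext_of_charFun (funext fun s => ?_)
  have hcont : Continuous fun x : ℂ => Complex.exp (inner ℝ x s * Complex.I) := by fun_prop
  rw [charFun_apply, charFun_apply, integral_map hm hcont.aestronglyMeasurable,
    integral_map hm' hcont.aestronglyMeasurable]
  have hlim : ∀ {x : TreeVertex → Ω → ℝ}, IsPWIT P (twoSidedLebesgue θ) x → Tendsto
      (fun n => ∫ ω, Complex.exp
        (inner ℝ (depthResolvent α z n fun v => x v ω) s * Complex.I) ∂P) atTop
      (𝓝 (∫ ω, Complex.exp (inner ℝ (rootResolvent α (fun v => x v ω) z) s * Complex.I) ∂P)) := by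
    intro x hx
    refine IsMarkedPoisson.tendsto_integral_exp (fun n => hx.aemeasurable_depthResolvent n) ?_ s
    filter_upwards [hx.ae_goodMarks hα hα2 hθ hθ1] with ω hω
    exact hω.tendsto_depthResolvent hz.ne'
  refine tendsto_nhds_unique (hlim hy) ((hlim hy').congr fun n => ?_)
  exact ((IsPWIT.identDistrib_depthResolvent hα hα2 hθ hθ1 hz n hy' hy).comp
    hcont.measurable).integral_eq

end Law

end

/-! ### Comparison of the tree recursion with an arbitrary marked Poisson sum -/

theorem mainTheorem9 (α θ : ℝ) (hα : 0 < α) (hα2 : α < 2) (hθ : 0 ≤ θ) (hθ1 : θ ≤ 1)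
    {Ω : Type*} [MeasurableSpace Ω] (P : Measure Ω) [IsProbabilityMeasure P]
    (y : TreeVertex → Ω → ℝ) (hy : IsPWIT P (twoSidedLebesgue θ) y) :
    (∀ᵐ ω ∂P, TreeColumnsSquareSummable α (fun v => y v ω) ∧
      IsSelfAdjoint (treeOperator α fun v => y v ω)) ∧
    (∀ᵐ ω ∂P, ∀ z : ℂ, 0 < z.im →
      rootResolvent α (fun v => y v ω) (-conj z) = -conj (rootResolvent α (fun v => y v ω) z)) ∧
    ∀ z : ℂ, 0 < z.im →
      AEMeasurable (fun ω => rootResolvent α (fun v => y v ω) z) P ∧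
      ∀ {Ω' : Type*} [MeasurableSpace Ω'] (P' : Measure Ω') [IsProbabilityMeasure P']
        (h : ℕ → Ω' → ℂ) (ξ : ℕ → Ω' → ℝ),
        (∀ k, IdentDistrib (h k) (fun ω => rootResolvent α (fun v => y v ω) z) P' P) →
        iIndepFun h P' →
        IsPoissonPointProcess P' ξ (stableIntensity α) →
        IndepFun (fun ω k => h k ω) (fun ω k => ξ k ω) P' →
        (∀ᵐ ω ∂P', Summable (fun k => (ξ k ω : ℂ) * h k ω) ∧
          z + ∑' k, (ξ k ω : ℂ) * h k ω ≠ 0) ∧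
        IdentDistrib (fun ω => rootResolvent α (fun v => y v ω) z)
          (fun ω => -(z + ∑' k, (ξ k ω : ℂ) * h k ω)⁻¹) P P' := by
  have hgood := hy.ae_goodMarks hα hα2 hθ hθ1
  refine ⟨?_, ?_, fun z hz => ⟨hy.aemeasurable_rootResolvent hα hα2 hθ hθ1 hz, ?_⟩⟩
  · filter_upwards [hgood] with ω hω using ⟨hω.columns, hω.isSelfAdjoint⟩
  · filter_upwards [hgood] with ω hω z hz using hω.rootResolvent_neg_conj hz.ne'
  intro Ω' _ P' _ h ξ hh hind hξ hindξ
  have hν := isSummableIntensity_stableIntensity hα hα2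
  have hm := hy.aemeasurable_rootResolvent hα hα2 hθ hθ1 hz
  set μ := P.map fun ω => rootResolvent α (fun v => y v ω) z with hμ
  have H' : IsMarkedPoisson P' ξ h (stableIntensity α) μ :=
    ⟨hξ, fun k => ⟨(hh k).aemeasurable_fst, (hh k).map_eq⟩, hind, hindξ⟩
  -- Independence is transferred through a measurable function of the mark rows, so the subtree
  -- resolvents are replaced by this almost surely equal version.
  have hlim : ∀ k, (fun ω => limitResolvent α z (markRows (fun v => y (k :: v)) ω)) =ᵐ[P]
      fun ω => rootResolvent α (subMarks (fun v => y v ω) k) z := fun k => by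
    filter_upwards [hgood] with ω hω using (hω.subMarks k).limitResolvent_eq
      (y := fun v => y (k :: v)) hz.ne'
  have H := hy.isMarkedPoisson hα hθ hθ1 (measurable_limitResolvent (α := α) z) (μ := μ)
    fun k => ⟨((measurable_limitResolvent z).comp
      (hy.subtree k).measurable_markRows).aemeasurable, by
        rw [Measure.map_congr (hlim k)]
        exact ((hy.subtree k).identDistrib_rootResolvent hα hα2 hθ hθ1 hz hy).map_eq⟩
  have hC : ∀ᵐ w ∂μ, ‖w‖ ≤ 1 / z.im := by
    rw [ae_map_iff hm (measurableSet_le measurable_norm measurable_const)]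
    filter_upwards [hgood] with ω hω using hω.norm_rootResolvent_le hz
  have him : ∀ᵐ ω ∂P', ∀ k, 0 ≤ (h k ω).im := by
    have : ∀ᵐ w ∂μ, 0 ≤ w.im := by
      rw [ae_map_iff hm (measurableSet_le measurable_const Complex.measurable_im)]
      filter_upwards [hgood] with ω hω
      rw [hω.im_rootResolvent hz.ne']
      positivity
    refine ae_all_iff.2 fun k => ae_of_ae_map (p := fun w => 0 ≤ w.im) (hh k).aemeasurable_fst ?_
    rwa [(hh k).map_eq]
  constructor
  · filter_upwards [H'.ae_summable hν hC (g := id) fun x hx => (abs_of_nonneg hx).le,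
      hξ.ae_pos hν, him] with ω hs hpos him
    simp only [id_eq, Complex.real_smul] at hs
    -- The denominator has imaginary part at least Im z > 0.
    refine ⟨hs, fun h0 => ?_⟩
    have h1 := congrArg Complex.im h0
    rw [Complex.add_im, Complex.im_tsum hs, Complex.zero_im] at h1
    have h2 : 0 ≤ ∑' k, ((ξ k ω : ℂ) * h k ω).im := tsum_nonneg fun k => by
      rw [Complex.im_ofReal_mul]
      exact mul_nonneg (hpos k).le (him k)
    linarith
  · have h1 := (H.identDistrib_tsum H' hν hC).comp (u := fun w => -(z + w)⁻¹)
      (measurable_id.const_add z).inv.neg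
    simp only [Complex.real_smul] at h1
    refine (IdentDistrib.of_ae_eq hm ?_).trans h1
    filter_upwards [hgood, ae_all_iff.2 hlim] with ω hω hl
    rw [hω.rootResolvent_recursion hz.ne']
    simp only [Function.comp_apply]
    congr 3
    exact tsum_congr fun k => by rw [hl k]
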